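/- **Setting.** Let $d\in\{2,3\}$, let $\rho_1,\rho_2,\mu_1,\mu_2,\mathrm{Re},\mathrm{We},\mathrm{Fr},\varepsilon>0$, $\epsilon\ge 0$, $\mathcal C\ge 0$, let $\boldsymbol\jmath\in\mathbb R^d$ be a unit vector and $y=\mathbf x\cdot\boldsymbol\jmath$. Put $\|b\|_{\epsilon,2}=(b\cdot b+\epsilon^2)^{1/2}$ (Frobenius product for matrices), $H_\varepsilon(s)=H^p(s/\varepsilon)$ with $H^p(s)=0$ for $s<-1$, $H^p(s)=-\frac34s^5-\frac52s^4-\frac52s^3+\frac54s+\frac12$ for $-1\le s<0$, $H^p(s)=-\frac34s^5+\frac52s^4-\frac52s^3+\frac54s+\frac12$ for $0\le s<1$, $H^p(s)=1$ for $s\ge1$; $\delta=H_\varepsilon'$, $\rho(\phi)=\rho_1H_\varepsilon(\phi)+\rho_2(1-H_\varepsilon(\phi))$, $\mu(\phi)=\mu_1H_\varepsilon(\phi)+\mu_2(1-H_\varepsilon(\phi))$, $\varrho=\rho'$, $\boldsymbol\tau(\mathbf u,\phi)=\frac1{\mathrm{Re}}\mu(\phi)(\nabla\mathbf u+\nabla^T\mathbf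 u)$. **Mesh and spaces.** Let a tensor-product mesh of $\hat\Omega=(-1,1)^d$ with open elements $Q$ be given, let $\mathbf F$ be an injective $C^1$ map on $[-1,1]^d$ whose Jacobian $\mathbf J$ is everywhere invertible, and let $\Omega=\mathbf F(\hat\Omega)$, $\Omega_K=\mathbf F(Q)$, $h_K^2=\frac{h_Q^2}{d}\|\mathbf J\|_F^2$ with $h_Q$ the diagonal length of $Q$. Let $S$ be a tensor-product space of globally continuous splines on the mesh (arbitrary degrees and regularities). The discrete spaces are: velocities $\mathcal V^h$, the fields $\mathbf w$ with $\mathbf w\circ\mathbf F=(\det\mathbf J)^{-1}\mathbf J\hat{\mathbf w}$ on $[-1,1]^d$, where $\hat w_i$ lies in the spline space obtained from $S$ by raising degree and regularity by one in direction $i$, with $\mathbf w=0$ on $\partial\Omega$ and $\mathbf w$ of class $C^1$ on each $\overline{\Omega_K}$; pressures $\mathcal Q^h$, the zero-average functions $q$ with $\det(\mathbf J)\,(q\circ\mathbf F)\in S$; and one NURBS space $\Psi^h$ on the same mesh (quotients of continuous tensor-product splines by a fixed positive spline weight, composed with $\mathbf F^{-1}$) for both $\phi$ and $v$. **Semi-discrete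 formulation.** Let $T\in\mathbb R$ (only $T>0$ is of interest) and let $\tau_K$ be an arbitrary SUPG stabilization parameter. Let $\mathscr R_I\phi=\partial_t\phi+\mathbf u\cdot\nabla\phi$ and $\theta_K=\mathcal C h_K\|\mathscr R_M\|_{\epsilon,2}/\|\nabla\mathbf u^h\|_{\epsilon,2}$ with $\mathscr R_M=\partial_t(\rho\mathbf u)+\nabla\cdot(\rho\mathbf u\otimes\mathbf u)-\nabla\cdot\boldsymbol\tau+\nabla p+\frac1{\mathrm{We}}\delta(\phi)\kappa\nabla\phi+\frac1{\mathrm{Fr}^2}\rho\boldsymbol\jmath$ evaluated at the discrete solution and $\kappa=\nabla\cdot(\nabla\phi/\|\nabla\phi\|_{\epsilon,2})$. A smooth solution on $(0,T)$ is a quadruple $(\mathbf u^h,p^h,\phi^h,v^h)$ with values in $\mathcal V^h\times\mathcal Q^h\times\Psi^h\times\Psi^h$, each component being a finite combination of discrete functions with $C^1$ coefficients in time, with $\mathbf u^h,\phi^h$ of class $C^2$ and $p^h$ of class $C^1$ on each closed element $\overline{\Omega_K}$, with $\|\nabla\phi^h\|_{\epsilon,2}\ne0$ on every $\Omega_K$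 (automatic if $\epsilon>0$), such that for all $t\in(0,T)$ and all $(\mathbf w,q,\psi,\zeta)\in\mathcal V^h\times\mathcal Q^h\times\Psi^h\times\Psi^h$, with $\rho=\rho(\phi^h)$, $\varrho=\varrho(\phi^h)$, $$(\mathbf w,\partial_t(\rho\mathbf u^h))_\Omega-(\nabla\mathbf w,\rho\mathbf u^h\otimes\mathbf u^h)_\Omega-(\nabla\cdot\mathbf w,p^h)_\Omega+(\nabla\mathbf w,\boldsymbol\tau(\mathbf u^h,\phi^h))_\Omega+\tfrac1{\mathrm{Fr}^2}(\mathbf w,\rho\boldsymbol\jmath)_\Omega-(\mathbf w,v^h\nabla\phi^h)_\Omega$$ $$-\big(\mathbf w,\varrho\big(\tfrac{\|\mathbf u^h\|^2}2-\tfrac{y}{\mathrm{Fr}^2}\big)\nabla\phi^h\big)_\Omega+\sum_K(\nabla\mathbf w,\theta_K\nabla\mathbf u^h)_{\Omega_K}-\sum_K(\tau_K\mathbf w\cdot\nabla v^h,\mathscr R_I\phi^h)_{\Omega_K}=0,$$ $$(q,\nabla\cdot\mathbf u^h)_\Omega=0,\qquad(\psi,\partial_t\phi^h+\mathbf u^h\cdot\nabla\phi^h)_\Omega+\sum_K(\tau_K\mathbf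 u^h\cdot\nabla\psi,\mathscr R_I\phi^h)_{\Omega_K}=0,$$ $$\big(\zeta,v^h+\varrho\big(\tfrac{\|\mathbf u^h\|^2}2-\tfrac y{\mathrm{Fr}^2}\big)\big)_\Omega-\big(\tfrac1{\mathrm{We}}\delta(\phi^h)\tfrac{\nabla\phi^h}{\|\nabla\phi^h\|_{\epsilon,2}},\nabla\zeta\big)_\Omega-\big(\tfrac1{\mathrm{We}}\|\nabla\phi^h\|_{\epsilon,2}\delta'(\phi^h),\zeta\big)_\Omega=0.$$ **Theorem.** For every smooth solution and every $t\in(0,T)$: 1. if $\rho_2\le\rho_1$ (no loss of generality), then $\rho_2\le\rho(\phi^h)\le\rho_1$ on $\overline\Omega$; 2. $\nabla\cdot\mathbf u^h=0$ at every point of every element (where $\mathbf u^h$ is differentiable), at every other point of $\Omega$ at which $\mathbf u^h$ is differentiable, and in the sense of distributions on $\Omega$; 3. the energy $E^h=\int_\Omega\big(\frac12\rho(\phi^h)\|\mathbf u^h\|^2+\frac1{\mathrm{Fr}^2}\rho(\phi^h)y+\frac1{\mathrm{We}}\delta(\phi^h)\|\nabla\phi^h\|_{\epsilon,2}\big)$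 is differentiable in time and $$\frac{d}{dt}E^h=-(\nabla\mathbf u^h,\boldsymbol\tau(\mathbf u^h,\phi^h))_\Omega-\sum_K(\nabla\mathbf u^h,\theta_K\nabla\mathbf u^h)_{\Omega_K}\le0,$$ the integrals in $E^h$ and on the right-hand side being absolutely convergent; 4. $\psi=v^h$ and $\mathbf w=\mathbf u^h$ are admissible test functions, and with them the SUPG term of the level-set equation and its counterpart in the momentum equation add up to zero. -/

import Mathlib

open MeasureTheory Set
open scoped InnerProductSpace ContDiff

noncomputable section

namespace TwoPhase

/-- Physical space: `ℝ^d` with the Euclidean norm. -/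
abbrev Sp (d : ℕ) := EuclideanSpace ℝ (Fin d)

variable {d : ℕ}

/-! ### Vector calculus -/

/-- The `i`-th standard basis vector. -/
def basisVec (i : Fin d) : Sp d := EuclideanSpace.single i (1 : ℝ)

/-- Frobenius product `A : B = ∑ i j, A_ij B_ij` of two linear maps. -/
def frob (A B : Sp d →L[ℝ] Sp d) : ℝ := ∑ i, ⟪A (basisVec i), B (basisVec i)⟫_ℝ

/-- Divergence of a vector field. -/
def divergence (w : Sp d → Sp d) (x : Sp d) : ℝ := ∑ i, (fderiv ℝ w x (basisVec i)) i

/-- Row-wise divergence of a matrix field: `(∇ · A)_i = ∑ j, ∂_j A_ij`. -/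
def matDivergence (A : Sp d → Sp d →L[ℝ] Sp d) (x : Sp d) : Sp d :=
  ∑ j, fderiv ℝ (fun z => A z (basisVec j)) x (basisVec j)

/-- The regularized 2-norm of a vector, `(b · b + eps²)^(1/2)`. -/
def regNorm (eps : ℝ) (b : Sp d) : ℝ := Real.sqrt (⟪b, b⟫_ℝ + eps ^ 2)

/-- The regularized 2-norm of a matrix, `(A : A + eps²)^(1/2)`. -/
def regNormMat (eps : ℝ) (A : Sp d →L[ℝ] Sp d) : ℝ := Real.sqrt (frob A A + eps ^ 2)

/-! ### Data of the two-phase flow problem and constitutive relations -/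

/-- Densities and viscosities of the two fluids, Reynolds, Weber and Froude numbers, interface
half-width, regularization parameter of the 2-norm, discontinuity capturing constant, and
vertical unit vector. -/
structure FlowParams (d : ℕ) where
  rho1 : ℝ
  rho2 : ℝ
  mu1 : ℝ
  mu2 : ℝ
  Rey : ℝ
  We : ℝ
  Fr : ℝ
  width : ℝ
  eps : ℝ
  Cdc : ℝ
  vert : Sp d
  rho1_pos : 0 < rho1
  rho2_pos : 0 < rho2
  mu1_pos : 0 < mu1
  mu2_pos : 0 < mu2
  Rey_pos : 0 < Rey
  We_pos : 0 < We
  Fr_pos : 0 < Fr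
  width_pos : 0 < width
  eps_nonneg : 0 ≤ eps
  Cdc_nonneg : 0 ≤ Cdc
  norm_vert : ‖vert‖ = 1

/-- The piecewise polynomial regularization of the Heaviside function (unit half-width). -/
def heavisidePoly (s : ℝ) : ℝ :=
  if s < -1 then 0
  else if s < 0 then -(3 / 4) * s ^ 5 - 5 / 2 * s ^ 4 - 5 / 2 * s ^ 3 + 5 / 4 * s + 1 / 2
  else if s < 1 then -(3 / 4) * s ^ 5 + 5 / 2 * s ^ 4 - 5 / 2 * s ^ 3 + 5 / 4 * s + 1 / 2
  else 1

namespace FlowParams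

variable (par : FlowParams d)

/-- Regularized Heaviside function `H_ε(s) = H^p(s / ε)`. -/
def heaviside (s : ℝ) : ℝ := heavisidePoly (s / par.width)

/-- Regularized Dirac delta `δ = H_ε'`. -/
def dirac (s : ℝ) : ℝ := deriv par.heaviside s

/-- Derivative `δ'` of the regularized Dirac delta. -/
def diracDeriv (s : ℝ) : ℝ := deriv par.dirac s

/-- Density `ρ(φ) = ρ₁ H(φ) + ρ₂ (1 - H(φ))`. -/
def rho (s : ℝ) : ℝ := par.rho1 * par.heaviside s + par.rho2 * (1 - par.heaviside s)

/-- Viscosity `μ(φ) = μ₁ H(φ) + μ₂ (1 - H(φ))`. -/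
def mu (s : ℝ) : ℝ := par.mu1 * par.heaviside s + par.mu2 * (1 - par.heaviside s)

/-- `ϱ(φ) = ρ'(φ)`. -/
def drho (s : ℝ) : ℝ := deriv par.rho s

/-- Vertical coordinate `y = x · ȷ`. -/
def height (x : Sp d) : ℝ := ⟪x, par.vert⟫_ℝ

/-- Viscous stress `(1/Re) μ(φ) (∇u + (∇u)ᵀ)`. -/
def stress (u : Sp d → Sp d) (φ : Sp d → ℝ) (x : Sp d) : Sp d →L[ℝ] Sp d :=
  (par.Rey⁻¹ * par.mu (φ x)) •
    (fderiv ℝ u x + ContinuousLinearMap.adjoint (fderiv ℝ u x))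

/-- Extended interface normal `ν(φ) = ∇φ / ‖∇φ‖_{eps,2}`. -/
def normal (φ : Sp d → ℝ) (x : Sp d) : Sp d :=
  (regNorm par.eps (gradient φ x))⁻¹ • gradient φ x

/-- Curvature `κ(φ) = ∇ · ν(φ)`. -/
def curvature (φ : Sp d → ℝ) (x : Sp d) : ℝ := divergence (par.normal φ) x

/-- Energy density `½ ρ ‖u‖² + ρ y / Fr² + δ(φ) ‖∇φ‖_{eps,2} / We`. -/
def energyDensity (u : Sp d → Sp d) (φ : Sp d → ℝ) (x : Sp d) : ℝ :=
  1 / 2 * par.rho (φ x) * ‖u x‖ ^ 2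
    + 1 / par.Fr ^ 2 * (par.rho (φ x) * par.height x)
    + 1 / par.We * (par.dirac (φ x) * regNorm par.eps (gradient φ x))

/-- Conservative momentum residual
`∂ₜ(ρu) + ∇·(ρ u ⊗ u) - ∇·τ + ∇p + δ(φ) κ ∇φ / We + ρ ȷ / Fr²`. -/
def momentumResidual (u : ℝ → Sp d → Sp d) (p φ : ℝ → Sp d → ℝ) (t : ℝ) (x : Sp d) : Sp d :=
  deriv (fun s => par.rho (φ s x) • u s x) t
    + (∑ j, fderiv ℝ (fun z => (par.rho (φ t z) * u t z j) • u t z) x (basisVec j))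
    - matDivergence (par.stress (u t) (φ t)) x
    + gradient (p t) x
    + (1 / par.We * (par.dirac (φ t x) * par.curvature (φ t) x)) • gradient (φ t) x
    + (1 / par.Fr ^ 2 * par.rho (φ t x)) • par.vert

end FlowParams

/-- Level-set residual `∂ₜφ + u · ∇φ`. -/
def levelSetResidual (u : ℝ → Sp d → Sp d) (φ : ℝ → Sp d → ℝ) (t : ℝ) (x : Sp d) : ℝ :=
  deriv (fun s => φ s x) t + ⟪u t x, gradient (φ t) x⟫_ℝ

/-! ### Parametric mesh and spline spaces -/

/-- The open parametric cube `(-1,1)^d`. -/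
def openCube (d : ℕ) : Set (Sp d) := {ξ | ∀ i, ξ i ∈ Ioo (-1 : ℝ) 1}

/-- The closed parametric cube `[-1,1]^d`. -/
def closedCube (d : ℕ) : Set (Sp d) := {ξ | ∀ i, ξ i ∈ Icc (-1 : ℝ) 1}

/-- A tensor-product mesh of the parametric cube: breakpoints `-1 = ζ₀ < ⋯ < ζₙ = 1` in each
coordinate direction. -/
structure KnotMesh (d : ℕ) where
  num : Fin d → ℕ
  brk : (i : Fin d) → Fin (num i + 1) → ℝ
  brk_strictMono : ∀ i, StrictMono (brk i)
  brk_first : ∀ i, brk i 0 = -1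
  brk_last : ∀ i, brk i (Fin.last (num i)) = 1

namespace KnotMesh

variable (M : KnotMesh d)

/-- Index set of the elements. -/
abbrev Elem : Type := (i : Fin d) → Fin (M.num i)

/-- The (open) parametric element `Q`. -/
def box (K : M.Elem) : Set (Sp d) :=
  {ξ | ∀ i, ξ i ∈ Ioo (M.brk i (K i).castSucc) (M.brk i (K i).succ)}

/-- Element size `h_Q`: the diagonal length of `Q`. -/
def diam (K : M.Elem) : ℝ :=
  Real.sqrt (∑ i, (M.brk i (K i).succ - M.brk i (K i).castSucc) ^ 2)

end KnotMesh

/-- `s` restricted to `[ζ₀, ζₙ]` is a univariate spline of degree `k`: a polynomial of degree at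
most `k` on every knot interval, with `reg j` continuous derivatives across the interior
breakpoint `ζ_j`. The values at the end breakpoints of `reg` are not used. -/
def IsSpline {n : ℕ} (ζ : Fin (n + 1) → ℝ) (k : ℕ) (reg : Fin (n + 1) → ℕ) (s : ℝ → ℝ) : Prop :=
  ∃ P : Fin n → Polynomial ℝ,
    (∀ j, (P j).natDegree ≤ k) ∧
    (∀ j, ∀ x ∈ Icc (ζ j.castSucc) (ζ j.succ), s x = (P j).eval x) ∧
    (∀ i j : Fin n, (i : ℕ) + 1 = (j : ℕ) → ∀ m ≤ reg j.castSucc,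
      (Polynomial.derivative^[m] (P i)).eval (ζ j.castSucc)
        = (Polynomial.derivative^[m] (P j)).eval (ζ j.castSucc))

/-- Polynomial degrees and interelement regularities in each direction. -/
structure SplineType (M : KnotMesh d) where
  deg : Fin d → ℕ
  reg : (i : Fin d) → Fin (M.num i + 1) → ℕ

/-- Raise degree and regularity by one in direction `i`. -/
def SplineType.raise {M : KnotMesh d} (σ : SplineType M) (i : Fin d) : SplineType M where
  deg := fun j => if j = i then σ.deg j + 1 else σ.deg j
  reg := fun j a => if j = i then σ.reg j a + 1 else σ.reg j a

/-- Tensor-product spline space: linear span of products of univariate splines. -/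
def tensorSpline (M : KnotMesh d) (σ : SplineType M) : Submodule ℝ (Sp d → ℝ) :=
  Submodule.span ℝ {f | ∃ s : Fin d → ℝ → ℝ,
    (∀ i, IsSpline (M.brk i) (σ.deg i) (σ.reg i) (s i)) ∧ f = fun ξ => ∏ i, s i (ξ i)}

/-- Data of a NURBS space: a spline space and a positive weight function in it. -/
structure NurbsType (M : KnotMesh d) where
  spl : SplineType M
  weight : Sp d → ℝ
  weight_mem : weight ∈ tensorSpline M spl
  weight_pos : ∀ ξ ∈ closedCube d, 0 < weight ξ

/-! ### Geometry -/

/-- A geometrical map that is continuously differentiable, with continuously differentiable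
inverse, up to the boundary of the parametric cube. -/
structure GeometryMap (d : ℕ) where
  toFun : Sp d → Sp d
  contDiffOn : ContDiffOn ℝ 1 toFun (closedCube d)
  injOn : InjOn toFun (closedCube d)
  det_ne_zero : ∀ ξ ∈ closedCube d, (fderivWithin ℝ toFun (closedCube d) ξ).det ≠ 0

namespace GeometryMap

variable (G : GeometryMap d)

/-- Jacobian `J = ∂x/∂ξ`. -/
def jac (ξ : Sp d) : Sp d →L[ℝ] Sp d := fderivWithin ℝ G.toFun (closedCube d) ξ

/-- The physical domain `Ω`. -/
def domain : Set (Sp d) := G.toFun '' openCube d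

/-- The (open) physical element `Ω_K`. -/
def elem (M : KnotMesh d) (K : M.Elem) : Set (Sp d) := G.toFun '' M.box K

/-- Physical mesh size, `h_K² = (h_Q² / d) ‖J‖_F²`, at the physical point `x`. -/
def meshSize (M : KnotMesh d) (K : M.Elem) (x : Sp d) : ℝ :=
  Real.sqrt (M.diam K ^ 2 / d *
    frob (G.jac (Function.invFunOn G.toFun (closedCube d) x))
      (G.jac (Function.invFunOn G.toFun (closedCube d) x)))

/-! ### Discrete spaces -/

/-- Divergence-conforming spline velocity space with homogeneous boundary values: `w` is the Piola
transform of a parametric field whose `i`-th component is a spline with degree and regularity raised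
by one in direction `i`, vanishes on `∂Ω`, and is continuously differentiable up to the boundary
of every element. -/
def velocitySpace (M : KnotMesh d) (σ : SplineType M) : Set (Sp d → Sp d) :=
  {w | (∃ c : Fin d → Sp d → ℝ, (∀ i, c i ∈ tensorSpline M (σ.raise i)) ∧
        ∀ ξ ∈ closedCube d,
          w (G.toFun ξ) = (G.jac ξ).det⁻¹ • G.jac ξ (WithLp.toLp 2 fun i => c i ξ)) ∧
      (∀ x ∈ frontier G.domain, w x = 0) ∧
      ∀ K, ContDiffOn ℝ 1 w (closure (G.elem M K))}

/-- Pressure space: zero-average functions `q` such that `det(J) (q ∘ F)` is a spline. -/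
def pressureSpace (M : KnotMesh d) (σ : SplineType M) : Set (Sp d → ℝ) :=
  {q | (∃ c ∈ tensorSpline M σ, ∀ ξ ∈ closedCube d, q (G.toFun ξ) = (G.jac ξ).det⁻¹ * c ξ) ∧
      ∫ x in G.domain, q x = 0}

/-- NURBS space for the level-set function and for the additional variable. -/
def scalarSpace (M : KnotMesh d) (N : NurbsType M) : Set (Sp d → ℝ) :=
  {f | ∃ c ∈ tensorSpline M N.spl, ∀ ξ ∈ closedCube d, f (G.toFun ξ) = c ξ / N.weight ξ}

/-- The semi-discrete trial functions over a discrete space `S`: on `closure Ω` and for times in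
`(0,T)`, `f(t,x) = ∑ i, c_i(t) N_i(x)` with `N_i ∈ S` and continuously differentiable `c_i`. -/
def trialSpace {Y : Type*} [AddCommGroup Y] [Module ℝ Y] (S : Set (Sp d → Y)) (T : ℝ) :
    Set (ℝ → Sp d → Y) :=
  {f | ∃ (m : ℕ) (c : Fin m → ℝ → ℝ) (N : Fin m → Sp d → Y),
      (∀ i, N i ∈ S) ∧ (∀ i, ContDiffOn ℝ 1 (c i) (Ioo 0 T)) ∧
      ∀ t ∈ Ioo 0 T, ∀ x ∈ closure G.domain, f t x = ∑ i, c i t • N i x}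

end GeometryMap

/-! ### Semi-discrete formulation -/

section Formulation

variable (par : FlowParams d) (M : KnotMesh d) (G : GeometryMap d)

/-- Discontinuity capturing viscosity
`θ_K = C h_K ‖R_M‖_{eps,2} / ‖∇u‖_{eps,2}`. -/
def dcViscosity (u : ℝ → Sp d → Sp d) (p φ : ℝ → Sp d → ℝ) (K : M.Elem) (t : ℝ) (x : Sp d) : ℝ :=
  par.Cdc * G.meshSize M K x *
    (regNorm par.eps (par.momentumResidual u p φ t x)
      / regNormMat par.eps (fderiv ℝ (u t) x))

/-- The SUPG term `∑_K (τ_K u · ∇ψ, R_I φ)_{Ω_K}` of the level-set equation. -/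
def supgLevelSet (τ : M.Elem → ℝ → Sp d → ℝ) (u : ℝ → Sp d → Sp d) (φ : ℝ → Sp d → ℝ)
    (t : ℝ) (ψ : Sp d → ℝ) : ℝ :=
  ∑ K : M.Elem, ∫ x in G.elem M K,
    (τ K t x * ⟪u t x, gradient ψ x⟫_ℝ) * levelSetResidual u φ t x

/-- The counterpart `-∑_K (τ_K w · ∇v, R_I φ)_{Ω_K}` in the momentum equation. -/
def supgMomentum (τ : M.Elem → ℝ → Sp d → ℝ) (u : ℝ → Sp d → Sp d) (φ v : ℝ → Sp d → ℝ)
    (t : ℝ) (w : Sp d → Sp d) : ℝ :=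
  -∑ K : M.Elem, ∫ x in G.elem M K,
    (τ K t x * ⟪w x, gradient (v t) x⟫_ℝ) * levelSetResidual u φ t x

/-- The discontinuity capturing term `∑_K (∇w, θ_K ∇u)_{Ω_K}`. -/
def dcTerm (u : ℝ → Sp d → Sp d) (p φ : ℝ → Sp d → ℝ) (t : ℝ) (w : Sp d → Sp d) : ℝ :=
  ∑ K : M.Elem, ∫ x in G.elem M K,
    frob (fderiv ℝ w x) (dcViscosity par M G u p φ K t x • fderiv ℝ (u t) x)

/-- The viscous term `(∇w, τ(u,φ))_Ω`. -/
def viscousTerm (u : Sp d → Sp d) (φ : Sp d → ℝ) (w : Sp d → Sp d) : ℝ :=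
  ∫ x in G.domain, frob (fderiv ℝ w x) (par.stress u φ x)

/-- Left-hand side of the semi-discrete momentum equation. -/
def momentumForm (τ : M.Elem → ℝ → Sp d → ℝ) (u : ℝ → Sp d → Sp d) (p φ v : ℝ → Sp d → ℝ)
    (t : ℝ) (w : Sp d → Sp d) : ℝ :=
  (∫ x in G.domain, ⟪w x, deriv (fun s => par.rho (φ s x) • u s x) t⟫_ℝ)
    - (∫ x in G.domain, par.rho (φ t x) * ⟪fderiv ℝ w x (u t x), u t x⟫_ℝ)
    - (∫ x in G.domain, divergence w x * p t x)
    + viscousTerm par G (u t) (φ t) w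
    + 1 / par.Fr ^ 2 * (∫ x in G.domain, ⟪w x, par.rho (φ t x) • par.vert⟫_ℝ)
    - (∫ x in G.domain, ⟪w x, v t x • gradient (φ t) x⟫_ℝ)
    - (∫ x in G.domain, ⟪w x, (par.drho (φ t x) *
          (‖u t x‖ ^ 2 / 2 - 1 / par.Fr ^ 2 * par.height x)) • gradient (φ t) x⟫_ℝ)
    + dcTerm par M G u p φ t w
    + supgMomentum M G τ u φ v t w

/-- Left-hand side of the semi-discrete continuity equation. -/
def continuityForm (u : ℝ → Sp d → Sp d) (t : ℝ) (q : Sp d → ℝ) : ℝ :=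
  ∫ x in G.domain, q x * divergence (u t) x

/-- Left-hand side of the semi-discrete level-set equation. -/
def levelSetForm (τ : M.Elem → ℝ → Sp d → ℝ) (u : ℝ → Sp d → Sp d) (φ : ℝ → Sp d → ℝ)
    (t : ℝ) (ψ : Sp d → ℝ) : ℝ :=
  (∫ x in G.domain, ψ x * levelSetResidual u φ t x) + supgLevelSet M G τ u φ t ψ

/-- Left-hand side of the semi-discrete equation for the additional variable. -/
def additionalForm (u : ℝ → Sp d → Sp d) (φ v : ℝ → Sp d → ℝ) (t : ℝ) (ζ : Sp d → ℝ) : ℝ :=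
  (∫ x in G.domain, ζ x * (v t x + par.drho (φ t x) *
      (‖u t x‖ ^ 2 / 2 - 1 / par.Fr ^ 2 * par.height x)))
    - (∫ x in G.domain, ⟪(1 / par.We * par.dirac (φ t x)) • par.normal (φ t) x, gradient ζ x⟫_ℝ)
    - (∫ x in G.domain, 1 / par.We *
        (regNorm par.eps (gradient (φ t) x) * par.diracDeriv (φ t x)) * ζ x)

/-- Total energy `E^h`. -/
def energy (u : Sp d → Sp d) (φ : Sp d → ℝ) : ℝ := ∫ x in G.domain, par.energyDensity u φ x

/-- Smooth solutions of the semi-discrete formulation on `(0,T)`: trial functions which are smooth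
up to the boundary of every element (twice differentiable `u, φ`, once differentiable `p`), for which
the regularized norm `‖∇φ‖_{eps,2}` does not vanish (automatic for `eps > 0`), and which satisfy
the four weak equations for all test functions. -/
structure IsSmoothSolution (σ : SplineType M) (N : NurbsType M) (T : ℝ)
    (τ : M.Elem → ℝ → Sp d → ℝ) (u : ℝ → Sp d → Sp d) (p φ v : ℝ → Sp d → ℝ) : Prop where
  u_mem : u ∈ G.trialSpace (G.velocitySpace M σ) T
  p_mem : p ∈ G.trialSpace (G.pressureSpace M σ) T
  φ_mem : φ ∈ G.trialSpace (G.scalarSpace M N) T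
  v_mem : v ∈ G.trialSpace (G.scalarSpace M N) T
  u_smooth : ∀ t ∈ Ioo 0 T, ∀ K, ContDiffOn ℝ 2 (u t) (closure (G.elem M K))
  p_smooth : ∀ t ∈ Ioo 0 T, ∀ K, ContDiffOn ℝ 1 (p t) (closure (G.elem M K))
  φ_smooth : ∀ t ∈ Ioo 0 T, ∀ K, ContDiffOn ℝ 2 (φ t) (closure (G.elem M K))
  regNorm_ne_zero : ∀ t ∈ Ioo 0 T, ∀ K, ∀ x ∈ G.elem M K,
    regNorm par.eps (gradient (φ t) x) ≠ 0
  momentum : ∀ t ∈ Ioo 0 T, ∀ w ∈ G.velocitySpace M σ, momentumForm par M G τ u p φ v t w = 0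
  continuity : ∀ t ∈ Ioo 0 T, ∀ q ∈ G.pressureSpace M σ, continuityForm G u t q = 0
  levelSet : ∀ t ∈ Ioo 0 T, ∀ ψ ∈ G.scalarSpace M N, levelSetForm M G τ u φ t ψ = 0
  additional : ∀ t ∈ Ioo 0 T, ∀ ζ ∈ G.scalarSpace M N, additionalForm par G u φ v t ζ = 0

end Formulation

end TwoPhase

end

noncomputable section

namespace TwoPhase

open Filter Topology

variable {d : ℕ}

/-! ### The regularized Heaviside function and the constitutive relations -/

/-! The density bound is pointwise: `rho` is an affine combination of two densities with weight the
regularized Heaviside function, which lies in [0,1] (`heavisidePoly_mem_Icc`).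

Incompressibility rests on the fact that the divergence of a discrete velocity is an admissible
pressure. Since F is only C¹, the Piola identity div w = (det J)⁻¹ ∑ ∂_i ŵ_i is proved weakly.
Pulling ∫ ∇g · w back to the cube gives the constant sign of det J times ∫ ∑ ŵ_i ∂_i(g ∘ F).
Integration by parts along coordinate lines (`integral_lineDeriv_openCube_eq_zero`) moves the
derivatives onto ŵ, with no boundary terms because w = 0 on ∂Ω forces ŵ = 0 on the boundary of the
cube. This is `PiolaData.integral_fderiv_apply`; it exhibits `PiolaData.div` as the weak divergence.
Raising degree and regularity in direction i is what puts ∂_i ŵ_i in S, and g = 1 gives zero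
average. Testing the continuity equation with this function makes its L² norm vanish, and continuity
makes it vanish everywhere (`PiolaData.div_eq_zero`). Inside elements it is the classical divergence
(`PiolaData.divergence_eq`).

For the energy, take w = u in the momentum equation, ψ = v in the level-set equation and ζ = ∂ₜφ in
the additional equation; add the first two and subtract the third. All terms in v cancel, the two
SUPG terms cancel, and the pressure term is zero. What remains is dE/dt plus the two dissipation
terms, minus ∫ u · ∇(ρ(|u|²/2 − y/Fr²)), and this last integral is zero by weak incompressibility
(`TimeDerivs.energy_balance`). Both dissipation terms are nonnegative: ∇u : (∇u + ∇uᵀ) is half a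
square, and θ_K ≥ 0.

The analytic work consists of bounds, uniform on compact time intervals for the energy density and
its time derivative, that permit differentiation under the integral and splitting of integrals. They
are delicate only for κ∇φ and θ_K, whose denominators may degenerate. -/

theorem hasDerivAt_posPart_pow (n : ℕ) (x : ℝ) :
    HasDerivAt (fun y : ℝ => max y 0 ^ (n + 2)) ((n + 2) * max x 0 ^ (n + 1)) x := by
  rcases lt_trichotomy x 0 with h | h | h
  · rw [max_eq_right h.le]
    refine ((hasDerivAt_const x (0 : ℝ)).congr_of_eventuallyEq ?_).congr_deriv (by simp)
    filter_upwards [Iio_mem_nhds h] with y hy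
    simp [max_eq_right ((mem_Iio.1 hy).le)]
  · subst h
    have h1 : HasDerivWithinAt (fun y : ℝ => max y 0 ^ (n + 2)) 0 (Iic 0) 0 :=
      (hasDerivWithinAt_const (0 : ℝ) (Iic 0) (0 : ℝ)).congr
        (fun y hy => by simp [max_eq_right (mem_Iic.1 hy)]) (by simp)
    have h2 : HasDerivWithinAt (fun y : ℝ => max y 0 ^ (n + 2)) 0 (Ici 0) 0 := by
      have h3 : HasDerivAt (fun y : ℝ => y ^ (n + 2)) 0 0 := by
        simpa using hasDerivAt_pow (n + 2) (0 : ℝ)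
      exact h3.hasDerivWithinAt.congr
        (fun y hy => by simp [max_eq_left (mem_Ici.1 hy)]) (by simp)
    have := h1.union h2
    rw [Iic_union_Ici, hasDerivWithinAt_univ] at this
    simpa using this
  · rw [max_eq_left h.le]
    have h3 : HasDerivAt (fun y : ℝ => y ^ (n + 2)) ((n + 2) * x ^ (n + 1)) x := by
      simpa using hasDerivAt_pow (n + 2) x
    refine h3.congr_of_eventuallyEq ?_
    filter_upwards [Ioi_mem_nhds h] with y hy
    simp [max_eq_left ((mem_Ioi.1 hy).le)]

theorem contDiff_posPart_pow (n : ℕ) : ContDiff ℝ n (fun y : ℝ => max y 0 ^ (n + 1)) := by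
  induction n with
  | zero =>
    rw [Nat.cast_zero, contDiff_zero]
    fun_prop
  | succ n ih =>
    rw [Nat.cast_succ, contDiff_succ_iff_deriv]
    refine ⟨fun x => (hasDerivAt_posPart_pow n x).differentiableAt, by simp, ?_⟩
    rw [show deriv (fun y : ℝ => max y 0 ^ (n + 1 + 1)) = fun y => ((n : ℝ) + 2) * max y 0 ^ (n + 1)
      from funext fun x => (hasDerivAt_posPart_pow n x).deriv]
    exact contDiff_const.mul ih

/-- A piecewise quintic with C³ joints is a sum of truncated powers of exponents 4 and 5. The
coefficients are the jumps of the polynomial pieces at −1, 0 and 1, expanded about each joint. -/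
theorem heavisidePoly_eq (s : ℝ) :
    heavisidePoly s = 5 / 4 * max (s + 1) 0 ^ 4 - 3 / 4 * max (s + 1) 0 ^ 5 + 5 * max s 0 ^ 4
      + 5 / 4 * max (s - 1) 0 ^ 4 + 3 / 4 * max (s - 1) 0 ^ 5 := by
  unfold heavisidePoly
  split_ifs with h1 h2 h3
  · rw [max_eq_right (by linarith), max_eq_right (by linarith), max_eq_right (by linarith)]; ring
  · rw [max_eq_left (by linarith), max_eq_right (by linarith), max_eq_right (by linarith)]; ring
  · rw [max_eq_left (by linarith), max_eq_left (by linarith), max_eq_right (by linarith)]; ring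
  · rw [max_eq_left (by linarith), max_eq_left (by linarith), max_eq_left (by linarith)]; ring

theorem contDiff_heavisidePoly : ContDiff ℝ 3 heavisidePoly := by
  have h4 : ContDiff ℝ 3 (fun y : ℝ => max y 0 ^ 4) := contDiff_posPart_pow 3
  have h5 : ContDiff ℝ 3 (fun y : ℝ => max y 0 ^ 5) :=
    (contDiff_posPart_pow 4).of_le (by norm_num)
  rw [funext heavisidePoly_eq]
  have hp : ContDiff ℝ 3 (fun s : ℝ => s + 1) := by fun_prop
  have hm : ContDiff ℝ 3 (fun s : ℝ => s - 1) := by fun_prop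
  exact ((((contDiff_const.mul (h4.comp hp)).sub (contDiff_const.mul (h5.comp hp))).add
    (contDiff_const.mul h4)).add (contDiff_const.mul (h4.comp hm))).add
    (contDiff_const.mul (h5.comp hm))

theorem heavisidePoly_mem_Icc (s : ℝ) : heavisidePoly s ∈ Icc (0 : ℝ) 1 := by
  unfold heavisidePoly
  split_ifs with h1 h2 h3
  · simp
  · have e : -(3 / 4) * s ^ 5 - 5 / 2 * s ^ 4 - 5 / 2 * s ^ 3 + 5 / 4 * s + 1 / 2
        = (s + 1) ^ 4 * (2 - 3 * s) / 4 := by ring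
    rw [e]
    -- Replacing the fourth power by s + 1 reduces the upper bound to the quadratic inequality (s +
    -- 1)(2 − 3s) ≤ 4. The other branch is the reflection s ↦ −s.
    have hb : (s + 1) ^ 4 ≤ (s + 1) := by
      have := pow_le_of_le_one (show 0 ≤ s + 1 by linarith) (by linarith) (n := 4) (by norm_num)
      linarith
    have h0 : 0 ≤ (s + 1) ^ 4 := by positivity
    constructor
    · have : 0 ≤ (s + 1) ^ 4 * (2 - 3 * s) := mul_nonneg h0 (by linarith)
      linarith
    · nlinarith [mul_le_mul_of_nonneg_right hb (show 0 ≤ 2 - 3 * s by linarith)]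
  · have e : -(3 / 4) * s ^ 5 + 5 / 2 * s ^ 4 - 5 / 2 * s ^ 3 + 5 / 4 * s + 1 / 2
        = 1 - (1 - s) ^ 4 * (2 + 3 * s) / 4 := by ring
    rw [e]
    have hb : (1 - s) ^ 4 ≤ (1 - s) := by
      have := pow_le_of_le_one (show 0 ≤ 1 - s by linarith) (by linarith) (n := 4) (by norm_num)
      linarith
    have h0 : 0 ≤ (1 - s) ^ 4 := by positivity
    constructor
    · nlinarith [mul_le_mul_of_nonneg_right hb (show 0 ≤ 2 + 3 * s by linarith)]
    · have : 0 ≤ (1 - s) ^ 4 * (2 + 3 * s) := mul_nonneg h0 (by linarith)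
      linarith
  · simp

namespace FlowParams

variable (par : FlowParams d)

theorem heaviside_mem_Icc (s : ℝ) : par.heaviside s ∈ Icc (0 : ℝ) 1 := heavisidePoly_mem_Icc _

theorem contDiff_heaviside : ContDiff ℝ 3 par.heaviside :=
  contDiff_heavisidePoly.comp (contDiff_id.div_const _)

theorem contDiff_dirac : ContDiff ℝ 2 par.dirac := by
  have h : ContDiff ℝ (2 + 1) par.heaviside := by
    have := par.contDiff_heaviside
    norm_num
    exact this
  exact (contDiff_succ_iff_deriv.1 h).2.2

theorem hasDerivAt_dirac (s : ℝ) : HasDerivAt par.dirac (par.diracDeriv s) s :=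
  (par.contDiff_dirac.differentiable (by norm_num) s).hasDerivAt

theorem continuous_diracDeriv : Continuous par.diracDeriv :=
  par.contDiff_dirac.continuous_deriv (by norm_num)

theorem contDiff_rho : ContDiff ℝ 2 par.rho := by
  have h := par.contDiff_heaviside.of_le (show (2 : WithTop ℕ∞) ≤ 3 by norm_num)
  exact (contDiff_const.mul h).add (contDiff_const.mul (contDiff_const.sub h))

theorem contDiff_mu : ContDiff ℝ 2 par.mu := by
  have h := par.contDiff_heaviside.of_le (show (2 : WithTop ℕ∞) ≤ 3 by norm_num)
  exact (contDiff_const.mul h).add (contDiff_const.mul (contDiff_const.sub h))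

theorem hasDerivAt_rho (s : ℝ) : HasDerivAt par.rho (par.drho s) s :=
  (par.contDiff_rho.differentiable (by norm_num) s).hasDerivAt

theorem continuous_drho : Continuous par.drho := par.contDiff_rho.continuous_deriv (by norm_num)

theorem rho_mem_Icc (h : par.rho2 ≤ par.rho1) (s : ℝ) :
    par.rho2 ≤ par.rho s ∧ par.rho s ≤ par.rho1 := by
  obtain ⟨h0, h1⟩ := par.heaviside_mem_Icc s
  unfold rho
  constructor <;> nlinarith

theorem mu_nonneg (s : ℝ) : 0 ≤ par.mu s := by
  obtain ⟨h0, h1⟩ := par.heaviside_mem_Icc s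
  have := par.mu1_pos
  have := par.mu2_pos
  exact add_nonneg (mul_nonneg (by linarith) h0) (mul_nonneg (by linarith) (by linarith))

theorem contDiff_height : ContDiff ℝ ⊤ par.height := contDiff_id.inner ℝ contDiff_const

theorem hasFDerivAt_height (x : Sp d) : HasFDerivAt par.height (innerSL ℝ par.vert) x := by
  have : par.height = innerSL ℝ par.vert := by
    ext y; simp [height, real_inner_comm]
  rw [this]
  exact ContinuousLinearMap.hasFDerivAt _

end FlowParams

/-! ### Frobenius product -/

theorem frob_smul_right (A B : Sp d →L[ℝ] Sp d) (c : ℝ) : frob A (c • B) = c * frob A B := by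
  simp [frob, inner_smul_right, Finset.mul_sum]

theorem frob_self_nonneg (A : Sp d →L[ℝ] Sp d) : 0 ≤ frob A A :=
  Finset.sum_nonneg fun _ _ => real_inner_self_nonneg

theorem inner_basisVec (w : Sp d) (i : Fin d) : ⟪basisVec i, w⟫_ℝ = w i := by
  simp [basisVec, EuclideanSpace.inner_single_left]

theorem sum_smul_basisVec (w : Sp d) : ∑ i, w i • (basisVec i : Sp d) = w := by
  have := (EuclideanSpace.basisFun (Fin d) ℝ).sum_repr w
  simpa [basisVec] using this

theorem frob_eq_sum (A B : Sp d →L[ℝ] Sp d) :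
    frob A B = ∑ i, ∑ j, A (basisVec i) j * B (basisVec i) j := by
  simp [frob, PiLp.inner_apply, mul_comm]

theorem adjoint_basisVec (A : Sp d →L[ℝ] Sp d) (i j : Fin d) :
    ContinuousLinearMap.adjoint A (basisVec i) j = A (basisVec j) i := by
  rw [← inner_basisVec, ContinuousLinearMap.adjoint_inner_right, ← inner_basisVec, real_inner_comm]

/-- The product equals half the squared Frobenius norm of A + Aᵀ, by symmetrizing the double sum. -/
theorem frob_add_adjoint_nonneg (A : Sp d →L[ℝ] Sp d) :
    0 ≤ frob A (A + ContinuousLinearMap.adjoint A) := by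
  have h : frob A (A + ContinuousLinearMap.adjoint A)
      = 1 / 2 * ∑ i, ∑ j, (A (basisVec i) j + A (basisVec j) i) ^ 2 := by
    rw [frob_eq_sum]
    have e : ∀ i j, (A (basisVec i) j + A (basisVec j) i) ^ 2
        = A (basisVec i) j * (A (basisVec i) j + A (basisVec j) i)
          + A (basisVec j) i * (A (basisVec j) i + A (basisVec i) j) := fun i j => by ring
    simp only [e, Finset.sum_add_distrib, add_apply, PiLp.add_apply,
      adjoint_basisVec]
    rw [Finset.sum_comm (f := fun i j =>
      A (basisVec j) i * (A (basisVec j) i + A (basisVec i) j))]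
    ring
  rw [h]
  positivity

theorem norm_le_regNorm (eps : ℝ) (b : Sp d) : ‖b‖ ≤ regNorm eps b := by
  unfold regNorm
  refine Real.le_sqrt_of_sq_le ?_
  rw [real_inner_self_eq_norm_sq]
  nlinarith [sq_nonneg eps]

theorem regNorm_nonneg (eps : ℝ) (b : Sp d) : 0 ≤ regNorm eps b := Real.sqrt_nonneg _

theorem continuous_regNorm (eps : ℝ) : Continuous (regNorm eps : Sp d → ℝ) := by
  unfold regNorm
  fun_prop

theorem regNormMat_nonneg (eps : ℝ) (A : Sp d →L[ℝ] Sp d) : 0 ≤ regNormMat eps A :=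
  Real.sqrt_nonneg _

theorem frob_self_le_regNormMat_sq (eps : ℝ) (A : Sp d →L[ℝ] Sp d) :
    frob A A ≤ regNormMat eps A ^ 2 := by
  unfold regNormMat
  rw [Real.sq_sqrt (by have := frob_self_nonneg A; positivity)]
  nlinarith [sq_nonneg eps]

/-! ### Mesh and splines -/

theorem isOpen_openCube : IsOpen (openCube d) := by
  simp only [openCube, ofPred_forall]
  exact isOpen_iInter_of_finite fun i => isOpen_Ioo.preimage (EuclideanSpace.proj i).continuous

/-- A closed coordinate box. -/
def closedRect (a b : Fin d → ℝ) : Set (Sp d) := {ξ | ∀ i, ξ i ∈ Icc (a i) (b i)}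

/-- An open coordinate box. -/
def openRect (a b : Fin d → ℝ) : Set (Sp d) := {ξ | ∀ i, ξ i ∈ Ioo (a i) (b i)}

theorem closedRect_eq (a b : Fin d → ℝ) :
    closedRect a b = (EuclideanSpace.equiv (Fin d) ℝ) ⁻¹' (univ.pi fun i => Icc (a i) (b i)) := by
  ext ξ; simp only [mem_preimage, mem_univ_pi]; rfl

theorem openRect_eq (a b : Fin d → ℝ) :
    openRect a b = (EuclideanSpace.equiv (Fin d) ℝ) ⁻¹' (univ.pi fun i => Ioo (a i) (b i)) := by
  ext ξ; simp only [mem_preimage, mem_univ_pi]; rfl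

theorem isOpen_openRect (a b : Fin d → ℝ) : IsOpen (openRect a b) := by
  rw [openRect_eq]
  exact (isOpen_set_pi finite_univ fun i _ => isOpen_Ioo).preimage
    (EuclideanSpace.equiv (Fin d) ℝ).continuous

theorem isCompact_closedRect (a b : Fin d → ℝ) : IsCompact (closedRect a b) := by
  rw [closedRect_eq]
  exact (EuclideanSpace.equiv (Fin d) ℝ).toHomeomorph.isCompact_preimage.2
    (isCompact_univ_pi fun i => isCompact_Icc)

theorem closure_openRect {a b : Fin d → ℝ} (h : ∀ i, a i < b i) :
    closure (openRect a b) = closedRect a b := by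
  have := (EuclideanSpace.equiv (Fin d) ℝ).toHomeomorph.preimage_closure
    (univ.pi fun i => Ioo (a i) (b i))
  rw [openRect_eq, closedRect_eq]
  refine Eq.trans this.symm ?_
  rw [closure_pi_set]
  simp only [closure_Ioo (h _).ne]
  rfl

theorem convex_closedRect (a b : Fin d → ℝ) : Convex ℝ (closedRect a b) := by
  intro x hx y hy s t hs ht hst i
  exact convex_Icc (a i) (b i) (hx i) (hy i) hs ht hst

theorem openRect_subset (a b : Fin d → ℝ) : openRect a b ⊆ closedRect a b :=
  fun _ h i => Ioo_subset_Icc_self (h i)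

theorem nonempty_openRect {a b : Fin d → ℝ} (h : ∀ i, a i < b i) : (openRect a b).Nonempty :=
  ⟨WithLp.toLp 2 fun i => (a i + b i) / 2, fun i => by
    constructor <;> simp <;> linarith [h i]⟩

theorem uniqueDiffOn_closedRect {a b : Fin d → ℝ} (h : ∀ i, a i < b i) :
    UniqueDiffOn ℝ (closedRect a b) := by
  refine uniqueDiffOn_convex (convex_closedRect a b) ?_
  obtain ⟨x, hx⟩ := nonempty_openRect h
  exact ⟨x, interior_maximal (openRect_subset a b) (isOpen_openRect a b) hx⟩

theorem openCube_subset : openCube d ⊆ closedCube d := openRect_subset _ _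

theorem isCompact_closedCube : IsCompact (closedCube d) := isCompact_closedRect _ _

theorem closure_openCube : closure (openCube d) = closedCube d :=
  closure_openRect fun _ => by norm_num

theorem volume_hyperplane (i : Fin d) (c : ℝ) : volume {ξ : Sp d | ξ i = c} = 0 := by
  have h := (EuclideanSpace.volume_preserving_symm_measurableEquiv_toLp (Fin d)).measure_preimage_equiv
    {x : Fin d → ℝ | x i = c}
  have h0 : volume {x : Fin d → ℝ | x i = c} = 0 := by
    rw [volume_pi]
    exact Measure.pi_hyperplane (α := fun _ : Fin d => ℝ) (fun _ => volume) i c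
  rw [h0] at h
  exact h

namespace KnotMesh

variable (M : KnotMesh d)

/-- The closed parametric element. -/
def closedBox (K : M.Elem) : Set (Sp d) :=
  closedRect (fun i => M.brk i (K i).castSucc) fun i => M.brk i (K i).succ

theorem brk_lt (K : M.Elem) (i : Fin d) : M.brk i (K i).castSucc < M.brk i (K i).succ :=
  M.brk_strictMono i Fin.castSucc_lt_succ

theorem brk_mem (i : Fin d) (j : Fin (M.num i + 1)) : M.brk i j ∈ Icc (-1 : ℝ) 1 := by
  constructor
  · rw [← M.brk_first i]
    exact (M.brk_strictMono i).monotone (Fin.zero_le j)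
  · rw [← M.brk_last i]
    exact (M.brk_strictMono i).monotone (Fin.le_last j)

theorem isOpen_box (K : M.Elem) : IsOpen (M.box K) := isOpen_openRect _ _

theorem isCompact_closedBox (K : M.Elem) : IsCompact (M.closedBox K) := isCompact_closedRect _ _

theorem closure_box (K : M.Elem) : closure (M.box K) = M.closedBox K :=
  closure_openRect (M.brk_lt K)

theorem box_subset_closedBox (K : M.Elem) : M.box K ⊆ M.closedBox K := openRect_subset _ _

theorem closedBox_subset (K : M.Elem) : M.closedBox K ⊆ closedCube d :=
  fun _ h i => ⟨(M.brk_mem i _).1.trans (h i).1, (h i).2.trans (M.brk_mem i _).2⟩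

theorem box_subset_openCube (K : M.Elem) : M.box K ⊆ openCube d :=
  fun _ h i => ⟨(M.brk_mem i _).1.trans_lt (h i).1, (h i).2.trans_le (M.brk_mem i _).2⟩

theorem exists_knot_interval (i : Fin d) {x : ℝ} (hx : x ∈ Icc (-1 : ℝ) 1) :
    ∃ j : Fin (M.num i), x ∈ Icc (M.brk i j.castSucc) (M.brk i j.succ) := by
  by_contra! h
  have key : ∀ j, M.brk i j ≤ x := by
    intro j
    induction j using Fin.induction with
    | zero => rw [M.brk_first]; exact hx.1
    | succ j ih =>
      by_contra! hlt
      exact h j ⟨ih, hlt.le⟩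
  have hlast := key (Fin.last _)
  have hx1 : x = 1 := le_antisymm hx.2 (by rw [M.brk_last] at hlast; exact hlast)
  -- With no intervals the single breakpoint would be both −1 and 1. Otherwise the last interval
  -- contains x = 1.
  obtain hn | ⟨m, hm⟩ : M.num i = 0 ∨ ∃ m : Fin (M.num i), m.succ = Fin.last (M.num i) := by
    rcases Nat.eq_zero_or_pos (M.num i) with h0 | h0
    · exact Or.inl h0
    · exact Or.inr ⟨⟨M.num i - 1, by omega⟩, by ext; simp; omega⟩
  · have h1 := M.brk_first i
    have h2 := M.brk_last i
    rw [show Fin.last (M.num i) = 0 from by ext; simp [hn]] at h2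
    linarith
  · refine h m ⟨key _, ?_⟩
    rw [hm, M.brk_last, hx1]

theorem iUnion_closedBox : ⋃ K, M.closedBox K = closedCube d := by
  refine subset_antisymm (iUnion_subset M.closedBox_subset) fun ξ hξ => ?_
  choose K hK using fun i => M.exists_knot_interval i (hξ i)
  exact mem_iUnion.2 ⟨K, hK⟩

/-- The union of the open parametric elements. -/
def boxes : Set (Sp d) := ⋃ K, M.box K

theorem isOpen_boxes : IsOpen M.boxes := isOpen_iUnion M.isOpen_box

theorem boxes_subset_openCube : M.boxes ⊆ openCube d := iUnion_subset M.box_subset_openCube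

theorem mem_boxes_of_forall_ne {ξ : Sp d} (hξ : ξ ∈ closedCube d)
    (h : ∀ i j, ξ i ≠ M.brk i j) : ξ ∈ M.boxes := by
  rw [← M.iUnion_closedBox, mem_iUnion] at hξ
  obtain ⟨K, hK⟩ := hξ
  exact mem_iUnion.2 ⟨K, fun i => ⟨lt_of_le_of_ne (hK i).1 (h i _).symm,
    lt_of_le_of_ne (hK i).2 (h i _)⟩⟩

theorem volume_closedCube_diff_boxes : volume (closedCube d \ M.boxes) = 0 := by
  have hsub : closedCube d \ M.boxes ⊆ ⋃ i, ⋃ j, {ξ : Sp d | ξ i = M.brk i j} := by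
    rintro ξ ⟨h1, h2⟩
    by_contra h
    simp only [mem_iUnion, mem_ofPred_eq, not_exists] at h
    exact h2 (M.mem_boxes_of_forall_ne h1 h)
  refine measure_mono_null hsub ?_
  rw [measure_iUnion_null_iff]
  intro i
  rw [measure_iUnion_null_iff]
  exact fun j => volume_hyperplane i _

theorem volume_openCube_diff_boxes : volume (openCube d \ M.boxes) = 0 :=
  measure_mono_null (sdiff_subset_sdiff_left openCube_subset) M.volume_closedCube_diff_boxes

theorem continuousOn_closedCube {Y : Type*} [TopologicalSpace Y] {f : Sp d → Y}
    (h : ∀ K, ContinuousOn f (M.closedBox K)) : ContinuousOn f (closedCube d) := by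
  rw [← M.iUnion_closedBox]
  exact (locallyFinite_of_finite _).continuousOn_iUnion
    (fun K => (M.isCompact_closedBox K).isClosed) h

end KnotMesh

/-- Differentiating every piece lowers degree and regularity by one. The pieces glue to a
single-valued function because the raised regularity is at least one. -/
theorem IsSpline.exists_deriv {n : ℕ} {ζ : Fin (n + 1) → ℝ} (hζ : StrictMono ζ) {k : ℕ}
    {reg : Fin (n + 1) → ℕ} {s : ℝ → ℝ} (hs : IsSpline ζ (k + 1) (fun a => reg a + 1) s) :
    ∃ s' : ℝ → ℝ, IsSpline ζ k reg s' ∧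
      ∀ j : Fin n, ∀ x ∈ Ioo (ζ j.castSucc) (ζ j.succ), HasDerivAt s (s' x) x := by
  classical
  obtain ⟨P, hdeg, hval, hreg⟩ := hs
  -- At a breakpoint the chosen interval is arbitrary; `aux` shows that the choice is immaterial.
  -- The value 0 off the mesh plays no role.
  let s' : ℝ → ℝ := fun x =>
    if h : ∃ j : Fin n, x ∈ Icc (ζ j.castSucc) (ζ j.succ) then (P h.choose).derivative.eval x else 0
  have aux : ∀ i j : Fin n, i < j → ∀ x ∈ Icc (ζ i.castSucc) (ζ i.succ),
      x ∈ Icc (ζ j.castSucc) (ζ j.succ) →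
      (P i).derivative.eval x = (P j).derivative.eval x := by
    intro i j hij x hi hj
    have hle : i.succ ≤ j.castSucc := by
      rw [Fin.le_iff_val_le_val]; simpa [Nat.succ_le_iff] using hij
    have h1 : ζ i.succ = ζ j.castSucc :=
      le_antisymm (hζ.monotone hle) (hj.1.trans hi.2)
    have h2 := hζ.injective h1
    have h3 : (i : ℕ) + 1 = j := by simpa [Fin.ext_iff] using h2
    have hx : x = ζ j.castSucc := le_antisymm (hi.2.trans h1.le) hj.1
    -- Order one is covered for every `reg`, including `reg = 0`, since 1 ≤ `reg` + 1.
    have := hreg i j h3 1 (Nat.succ_le_succ (Nat.zero_le _))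
    simpa [hx] using this
  have hs' : ∀ j : Fin n, ∀ x ∈ Icc (ζ j.castSucc) (ζ j.succ),
      s' x = (P j).derivative.eval x := by
    intro j x hx
    have h : ∃ j : Fin n, x ∈ Icc (ζ j.castSucc) (ζ j.succ) := ⟨j, hx⟩
    simp only [s', dif_pos h]
    rcases lt_trichotomy h.choose j with hlt | heq | hlt
    · exact aux _ _ hlt x h.choose_spec hx
    · rw [heq]
    · exact (aux _ _ hlt x hx h.choose_spec).symm
  refine ⟨s', ⟨fun j => (P j).derivative, fun j => ?_, hs', fun i j hij m hm => ?_⟩,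
    fun j x hx => ?_⟩
  · exact (Polynomial.natDegree_derivative_le _).trans (by have := hdeg j; omega)
  · have := hreg i j hij (m + 1) (Nat.succ_le_succ hm)
    simpa using this
  · rw [hs' j x (Ioo_subset_Icc_self hx)]
    refine ((P j).hasDerivAt x).congr_of_eventuallyEq ?_
    filter_upwards [Ioo_mem_nhds hx.1 hx.2] with y hy
    exact hval j y (Ioo_subset_Icc_self hy)

/-! ### Elementwise smoothness and differentiation of tensor-product splines. -/

variable {M : KnotMesh d} {σ : SplineType M}

/-- On one closed element each spline is a polynomial, and the polynomial is defined on all of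
space. The extension gives derivatives up to the element boundary without one-sided notions. -/
theorem exists_contDiff_eqOn_closedBox {c : Sp d → ℝ} (hc : c ∈ tensorSpline M σ) (K : M.Elem) :
    ∃ g : Sp d → ℝ, ContDiff ℝ ∞ g ∧ EqOn c g (M.closedBox K) := by
  induction hc using Submodule.span_induction with
  | mem c hc =>
    obtain ⟨s, hs, rfl⟩ := hc
    choose P hdeg hval hreg using hs
    refine ⟨fun ξ => ∏ i, (P i (K i)).eval (ξ i), ?_, fun ξ hξ => ?_⟩
    · exact contDiff_prod fun i _ => (show ContDiff ℝ ∞ fun x => (P i (K i)).eval x by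
          simpa using (P i (K i)).contDiff_aeval (𝕜 := ℝ) ∞).comp
        (EuclideanSpace.proj (𝕜 := ℝ) i).contDiff
    · exact Finset.prod_congr rfl fun i _ => hval i (K i) _ (hξ i)
  | zero => exact ⟨0, contDiff_const, fun _ _ => rfl⟩
  | add a b _ _ ha hb =>
    obtain ⟨f, hf, hf'⟩ := ha
    obtain ⟨g, hg, hg'⟩ := hb
    exact ⟨f + g, hf.add hg, fun ξ hξ => by simp [hf' hξ, hg' hξ]⟩
  | smul r a _ ha =>
    obtain ⟨f, hf, hf'⟩ := ha
    exact ⟨r • f, contDiff_const.smul hf, fun ξ hξ => by simp [hf' hξ]⟩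

theorem continuousOn_tensorSpline {c : Sp d → ℝ} (hc : c ∈ tensorSpline M σ) :
    ContinuousOn c (closedCube d) :=
  M.continuousOn_closedCube fun K => by
    obtain ⟨g, hg, h⟩ := exists_contDiff_eqOn_closedBox hc K
    exact hg.continuous.continuousOn.congr h

/-- For a product, only the i-th factor is differentiated, and only that factor was raised, so the
result has exactly the type σ. This is the compatibility between velocity and pressure spaces. -/
theorem exists_lineDeriv_mem_tensorSpline {i : Fin d} {c : Sp d → ℝ}
    (hc : c ∈ tensorSpline M (σ.raise i)) :
    ∃ c' ∈ tensorSpline M σ, ∀ ξ ∈ M.boxes, HasLineDerivAt ℝ c (c' ξ) ξ (basisVec i) := by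
  induction hc using Submodule.span_induction with
  | mem c hc =>
    obtain ⟨s, hs, rfl⟩ := hc
    have hi : IsSpline (M.brk i) (σ.deg i + 1) (fun a => σ.reg i a + 1) (s i) := by
      simpa [SplineType.raise] using hs i
    obtain ⟨s', hs', hder⟩ := hi.exists_deriv (M.brk_strictMono i)
    refine ⟨fun ξ => ∏ j, Function.update s i s' j (ξ j),
      Submodule.subset_span ⟨Function.update s i s', fun j => ?_, rfl⟩, fun ξ hξ => ?_⟩
    · rcases eq_or_ne j i with rfl | hj
      · simpa using hs'
      · simpa [SplineType.raise, hj] using hs j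
    · obtain ⟨K, hK⟩ := mem_iUnion.1 hξ
      have h1 : HasDerivAt (fun t : ℝ => s i (ξ i + t)) (s' (ξ i)) 0 := by
        have := hder (K i) (ξ i) (hK i)
        rw [← add_zero (ξ i)] at this
        simpa using this.comp_const_add (ξ i) 0
      have h2 := h1.mul_const (∏ j ∈ Finset.univ.erase i, s j (ξ j))
      unfold HasLineDerivAt
      refine (h2.congr_of_eventuallyEq (Filter.Eventually.of_forall fun t => ?_)).congr_deriv ?_
      · dsimp only
        rw [← Finset.mul_prod_erase _ _ (Finset.mem_univ i)]
        congr 1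
        · simp [basisVec]
        · refine Finset.prod_congr rfl fun j hj => ?_
          simp [basisVec, Finset.ne_of_mem_erase hj]
      · dsimp only
        rw [← Finset.mul_prod_erase _ _ (Finset.mem_univ i)]
        congr 1
        · simp
        · refine Finset.prod_congr rfl fun j hj => ?_
          simp [Finset.ne_of_mem_erase hj]
  | zero => exact ⟨0, Submodule.zero_mem _, fun ξ _ => hasDerivAt_const _ _⟩
  | add a b _ _ ha hb =>
    obtain ⟨f, hf, hf'⟩ := ha
    obtain ⟨g, hg, hg'⟩ := hb
    exact ⟨f + g, Submodule.add_mem _ hf hg, fun ξ hξ => HasDerivAt.add (hf' ξ hξ) (hg' ξ hξ)⟩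
  | smul r a _ ha =>
    obtain ⟨f, hf, hf'⟩ := ha
    exact ⟨r • f, Submodule.smul_mem _ r hf, fun ξ hξ => HasDerivAt.const_smul r (hf' ξ hξ)⟩

/-! ### Geometry -/

theorem uniqueDiffOn_closedCube : UniqueDiffOn ℝ (closedCube d) :=
  uniqueDiffOn_closedRect fun _ => by norm_num

namespace GeometryMap

variable (G : GeometryMap d)

theorem hasFDerivWithinAt {ξ : Sp d} (hξ : ξ ∈ closedCube d) :
    HasFDerivWithinAt G.toFun (G.jac ξ) (closedCube d) ξ :=
  (G.contDiffOn.differentiableOn (by norm_num) ξ hξ).hasFDerivWithinAt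

theorem contDiffAt {ξ : Sp d} (hξ : ξ ∈ openCube d) : ContDiffAt ℝ 1 G.toFun ξ :=
  G.contDiffOn.contDiffAt (mem_of_superset (isOpen_openCube.mem_nhds hξ) openCube_subset)

theorem hasFDerivAt {ξ : Sp d} (hξ : ξ ∈ openCube d) : HasFDerivAt G.toFun (G.jac ξ) ξ :=
  (G.hasFDerivWithinAt (openCube_subset hξ)).hasFDerivAt
    (mem_of_superset (isOpen_openCube.mem_nhds hξ) openCube_subset)

theorem continuousOn_toFun : ContinuousOn G.toFun (closedCube d) := G.contDiffOn.continuousOn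

theorem continuousOn_jac : ContinuousOn G.jac (closedCube d) :=
  G.contDiffOn.continuousOn_fderivWithin uniqueDiffOn_closedCube le_rfl

theorem continuousOn_det_jac : ContinuousOn (fun ξ => (G.jac ξ).det) (closedCube d) :=
  ContinuousLinearMap.continuous_det.comp_continuousOn G.continuousOn_jac

theorem det_jac_ne_zero {ξ : Sp d} (hξ : ξ ∈ closedCube d) : (G.jac ξ).det ≠ 0 :=
  G.det_ne_zero ξ hξ

/-- The Jacobian as a continuous linear equivalence. -/
def jacEquiv {ξ : Sp d} (hξ : ξ ∈ closedCube d) : Sp d ≃L[ℝ] Sp d :=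
  (G.jac ξ).toContinuousLinearEquivOfDetNeZero (G.det_jac_ne_zero hξ)

theorem coe_jacEquiv {ξ : Sp d} (hξ : ξ ∈ closedCube d) :
    (G.jacEquiv hξ : Sp d →L[ℝ] Sp d) = G.jac ξ := rfl

theorem jac_injective {ξ : Sp d} (hξ : ξ ∈ closedCube d) : Function.Injective (G.jac ξ) :=
  (G.jacEquiv hξ).injective

theorem jac_surjective {ξ : Sp d} (hξ : ξ ∈ closedCube d) : Function.Surjective (G.jac ξ) :=
  (G.jacEquiv hξ).surjective

theorem isOpen_image {s : Set (Sp d)} (hs : IsOpen s) (hsub : s ⊆ openCube d) :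
    IsOpen (G.toFun '' s) := by
  rw [isOpen_iff_mem_nhds]
  rintro _ ⟨ξ, hξ, rfl⟩
  have h1 := (G.contDiffAt (hsub hξ)).hasStrictFDerivAt' (G.hasFDerivAt (hsub hξ)) (by norm_num)
  have h2 : HasStrictFDerivAt G.toFun (G.jacEquiv (openCube_subset (hsub hξ)) : Sp d →L[ℝ] Sp d) ξ := h1
  rw [← h2.map_nhds_eq_of_equiv]
  exact image_mem_map (hs.mem_nhds hξ)

theorem isOpen_domain : IsOpen G.domain := G.isOpen_image isOpen_openCube Subset.rfl

theorem isOpen_elem (M : KnotMesh d) (K : M.Elem) : IsOpen (G.elem M K) :=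
  G.isOpen_image (M.isOpen_box K) (M.box_subset_openCube K)

theorem closure_image {s : Set (Sp d)} (hsub : closure s ⊆ closedCube d) :
    closure (G.toFun '' s) = G.toFun '' closure s := by
  refine subset_antisymm ?_ ((G.continuousOn_toFun.mono hsub).image_closure)
  have hc : IsCompact (closure s) := isCompact_closedCube.of_isClosed_subset isClosed_closure hsub
  exact closure_minimal (image_mono subset_closure)
    (hc.image_of_continuousOn (G.continuousOn_toFun.mono hsub)).isClosed

theorem closure_domain : closure G.domain = G.toFun '' closedCube d := by
  rw [domain, G.closure_image closure_openCube.subset, closure_openCube]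

theorem closure_elem (M : KnotMesh d) (K : M.Elem) :
    closure (G.elem M K) = G.toFun '' M.closedBox K := by
  rw [elem, G.closure_image ((M.closure_box K).subset.trans (M.closedBox_subset K)), M.closure_box]

theorem isCompact_closure_domain : IsCompact (closure G.domain) := by
  rw [closure_domain]
  exact isCompact_closedCube.image_of_continuousOn G.continuousOn_toFun

theorem isCompact_closure_elem (M : KnotMesh d) (K : M.Elem) : IsCompact (closure (G.elem M K)) := by
  rw [closure_elem]
  exact (M.isCompact_closedBox K).image_of_continuousOn
    (G.continuousOn_toFun.mono (M.closedBox_subset K))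

theorem elem_subset_domain (M : KnotMesh d) (K : M.Elem) : G.elem M K ⊆ G.domain :=
  image_mono (M.box_subset_openCube K)

/-- The box has unique derivatives and J is invertible, so F transports this property. Derivatives
within a closed element are thereby determined up to its boundary. -/
theorem uniqueDiffOn_closure_elem (M : KnotMesh d) (K : M.Elem) :
    UniqueDiffOn ℝ (closure (G.elem M K)) := by
  rw [closure_elem]
  rintro _ ⟨ξ, hξ, rfl⟩
  have hξ' := M.closedBox_subset K hξ
  exact ((G.hasFDerivWithinAt hξ').mono (M.closedBox_subset K)).uniqueDiffWithinAt
    (uniqueDiffOn_closedRect (M.brk_lt K) ξ hξ) (G.jac_surjective hξ').denseRange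

theorem toFun_mem_frontier {ξ : Sp d} (hξ : ξ ∈ closedCube d) (hξ' : ξ ∉ openCube d) :
    G.toFun ξ ∈ frontier G.domain := by
  rw [G.isOpen_domain.frontier_eq, G.closure_domain]
  refine ⟨mem_image_of_mem _ hξ, ?_⟩
  rintro ⟨η, hη, h⟩
  exact hξ' (G.injOn (openCube_subset hη) hξ h ▸ hη)

/-- The inverse of the geometrical map. -/
def inv : Sp d → Sp d := Function.invFunOn G.toFun (closedCube d)

theorem inv_toFun {ξ : Sp d} (hξ : ξ ∈ closedCube d) : G.inv (G.toFun ξ) = ξ :=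
  G.injOn.leftInvOn_invFunOn hξ

theorem inv_mem {x : Sp d} (hx : x ∈ closure G.domain) : G.inv x ∈ closedCube d := by
  rw [closure_domain] at hx
  obtain ⟨ξ, hξ, rfl⟩ := hx
  rwa [G.inv_toFun hξ]

theorem toFun_inv {x : Sp d} (hx : x ∈ closure G.domain) : G.toFun (G.inv x) = x := by
  rw [closure_domain] at hx
  obtain ⟨ξ, hξ, rfl⟩ := hx
  rw [G.inv_toFun hξ]

/-- F is a continuous injection of a compact set, so it sends closed subsets to closed sets. -/
theorem continuousOn_inv : ContinuousOn G.inv (closure G.domain) := by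
  rw [continuousOn_iff_isClosed]
  intro C hC
  refine ⟨G.toFun '' (closedCube d ∩ C), ?_, ?_⟩
  · exact ((isCompact_closedCube.inter_right hC).image_of_continuousOn
      (G.continuousOn_toFun.mono inter_subset_left)).isClosed
  · ext x
    constructor
    · rintro ⟨h1, h2⟩
      exact ⟨⟨G.inv x, ⟨G.inv_mem h2, h1⟩, G.toFun_inv h2⟩, h2⟩
    · rintro ⟨⟨ξ, ⟨h1, h2⟩, rfl⟩, h3⟩
      exact ⟨by rwa [mem_preimage, G.inv_toFun h1], h3⟩

theorem hasFDerivAt_inv {ξ : Sp d} (hξ : ξ ∈ openCube d) :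
    HasFDerivAt G.inv (G.jac ξ).inverse (G.toFun ξ) := by
  have hξ' := openCube_subset hξ
  have hmem : G.domain ∈ 𝓝 (G.toFun ξ) := G.isOpen_domain.mem_nhds (mem_image_of_mem _ hξ)
  have hcl : closure G.domain ∈ 𝓝 (G.toFun ξ) := mem_of_superset hmem subset_closure
  have := HasFDerivAt.of_local_left_inverse (f := G.toFun) (f' := G.jacEquiv hξ')
    (G.continuousOn_inv.continuousAt hcl)
    (by rw [G.inv_toFun hξ']; exact G.hasFDerivAt hξ)
    (by filter_upwards [hcl] with y hy using G.toFun_inv hy)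
  rw [← G.coe_jacEquiv hξ', ContinuousLinearMap.inverse_equiv]
  exact this

/-- A nonvanishing continuous determinant has constant sign on the connected cube. The sign s then
cancels |det J| against the Piola factor (det J)⁻¹ and leaves a constant outside the integrals. -/
theorem exists_sign_det :
    ∃ s : ℝ, ∀ ξ ∈ closedCube d, |(G.jac ξ).det| = s * (G.jac ξ).det := by
  have hpre : IsPreconnected (closedCube d) := (convex_closedRect _ _).isPreconnected
  by_cases h : ∃ ξ ∈ closedCube d, (G.jac ξ).det < 0
  · obtain ⟨ξ, hξ, hneg⟩ := h
    refine ⟨-1, fun η hη => ?_⟩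
    rw [abs_of_neg, neg_one_mul]
    by_contra! hpos
    obtain ⟨z, hz, hz0⟩ := hpre.intermediate_value hξ hη G.continuousOn_det_jac
      (show (0 : ℝ) ∈ Icc _ _ from ⟨hneg.le, hpos⟩)
    exact G.det_jac_ne_zero hz hz0
  · push Not at h
    exact ⟨1, fun η hη => by rw [abs_of_nonneg (h η hη), one_mul]⟩

theorem continuousOn_inverse_jac :
    ContinuousOn (fun ξ => (G.jac ξ).inverse) (closedCube d) := by
  intro ξ hξ
  have h1 : ContinuousAt (ContinuousLinearMap.inverse : (Sp d →L[ℝ] Sp d) → _)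
      (G.jacEquiv hξ : Sp d →L[ℝ] Sp d) :=
    (contDiffAt_map_inverse (n := 0) (G.jacEquiv hξ)).continuousAt
  rw [G.coe_jacEquiv hξ] at h1
  exact h1.comp_continuousWithinAt (G.continuousOn_jac ξ hξ)

theorem integral_domain (g : Sp d → ℝ) :
    ∫ x in G.domain, g x = ∫ ξ in openCube d, |(G.jac ξ).det| * g (G.toFun ξ) :=
  integral_image_eq_integral_abs_det_fderiv_smul volume isOpen_openCube.measurableSet
    (fun _ hξ => (G.hasFDerivAt hξ).hasFDerivWithinAt) (G.injOn.mono openCube_subset) g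

/-! ### The physical mesh skeleton is a null set. -/

variable (M : KnotMesh d)

/-- The union of the open elements. -/
def elems : Set (Sp d) := ⋃ K, G.elem M K

theorem elems_eq : G.elems M = G.toFun '' M.boxes := by
  rw [KnotMesh.boxes, image_iUnion]; rfl

theorem isOpen_elems : IsOpen (G.elems M) := isOpen_iUnion (G.isOpen_elem M)

theorem elems_subset_domain : G.elems M ⊆ G.domain := iUnion_subset (G.elem_subset_domain M)

theorem elem_subset_elems (K : M.Elem) : G.elem M K ⊆ G.elems M := subset_iUnion _ K

theorem volume_domain_diff_elems : volume (G.domain \ G.elems M) = 0 := by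
  rw [elems_eq, domain]
  refine measure_mono_null (t := G.toFun '' (openCube d \ M.boxes)) ?_ ?_
  · rintro _ ⟨⟨ξ, hξ, rfl⟩, h⟩
    exact ⟨ξ, ⟨hξ, fun h' => h ⟨ξ, h', rfl⟩⟩, rfl⟩
  refine addHaar_image_eq_zero_of_differentiableOn_of_addHaar_eq_zero volume ?_
    M.volume_openCube_diff_boxes
  exact (G.contDiffOn.differentiableOn (by norm_num)).mono (sdiff_subset.trans openCube_subset)

theorem domain_ae_eq_elems : G.domain =ᵐ[volume] G.elems M :=
  (ae_le_set.2 (G.volume_domain_diff_elems M)).antisymm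
    (LE.le.eventuallyLE (G.elems_subset_domain M))

theorem ae_mem_elems : ∀ᵐ x ∂(volume.restrict G.domain), x ∈ G.elems M := by
  rw [Measure.restrict_congr_set (G.domain_ae_eq_elems M)]
  exact ae_restrict_mem (G.isOpen_elems M).measurableSet

theorem setIntegral_domain_congr {f g : Sp d → ℝ} (h : ∀ x ∈ G.elems M, f x = g x) :
    ∫ x in G.domain, f x = ∫ x in G.domain, g x := by
  refine integral_congr_ae ?_
  filter_upwards [G.ae_mem_elems M] with x hx using h x hx

theorem volume_domain_lt_top : volume G.domain < ⊤ :=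
  (measure_mono subset_closure).trans_lt G.isCompact_closure_domain.measure_lt_top

theorem subset_closure_elems : closure G.domain ⊆ ⋃ K, closure (G.elem M K) := by
  rw [closure_domain, ← M.iUnion_closedBox, image_iUnion]
  exact iUnion_mono fun K => (G.closure_elem M K).symm.subset

end GeometryMap

/-! ### Divergence theorem on the parametric cube -/

/-- By Fubini the integral is taken line by line in direction i. Almost every line leaves the open
elements only at finitely many points, so the fundamental theorem of calculus with a countable
exceptional set applies to the continuous f, whose end values are zero. -/
theorem integral_lineDeriv_openCube_eq_zero {M : KnotMesh d} (i : Fin d) {f f' : Sp d → ℝ}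
    (hf : ContinuousOn f (closedCube d)) (h0 : ∀ ξ ∈ closedCube d, ξ ∉ openCube d → f ξ = 0)
    (hf' : IntegrableOn f' (openCube d))
    (hd : ∀ ξ ∈ M.boxes, HasLineDerivAt ℝ f (f' ξ) ξ (basisVec i)) :
    ∫ ξ in openCube d, f' ξ = 0 := by
  obtain ⟨n, rfl⟩ : ∃ n, d = n + 1 := ⟨d - 1, by have := i.pos; omega⟩
  let Φ : Sp (n + 1) ≃ᵐ ℝ × (Fin n → ℝ) :=
    (MeasurableEquiv.toLp 2 (Fin (n + 1) → ℝ)).symm.trans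
      (MeasurableEquiv.piFinSuccAbove (fun _ => ℝ) i)
  have hΦ : MeasurePreserving Φ volume volume :=
    (volume_preserving_piFinSuccAbove (fun _ : Fin (n + 1) => ℝ) i).comp
      (EuclideanSpace.volume_preserving_symm_measurableEquiv_toLp (Fin (n + 1)))
  let P : ℝ → (Fin n → ℝ) → Sp (n + 1) := fun t y => WithLp.toLp 2 (i.insertNth t y)
  have hPi : ∀ t y, P t y i = t := fun t y => by simp [P]
  have hPs : ∀ t y j, P t y (i.succAbove j) = y j := fun t y j => by simp [P]
  have hPΦ : ∀ ξ, P (Φ ξ).1 (Φ ξ).2 = ξ := fun ξ => by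
    ext j
    refine Fin.succAboveCases i ?_ (fun j => ?_) j
    · rw [hPi]; rfl
    · rw [hPs]; rfl
  let A : Set ℝ := Ioo (-1) 1
  let B : Set (Fin n → ℝ) := univ.pi fun _ => Ioo (-1) 1
  have hmem : ∀ t y, P t y ∈ openCube (n + 1) ↔ t ∈ A ∧ y ∈ B := fun t y => by
    simp only [openCube, mem_ofPred_eq, A, B, mem_univ_pi]
    rw [Fin.forall_iff_succAbove i]
    simp only [hPi, hPs]
  have hcube : openCube (n + 1) = Φ ⁻¹' (A ×ˢ B) := by
    ext ξ
    conv_lhs => rw [← hPΦ ξ]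
    rw [hmem]; rfl
  let F : ℝ × (Fin n → ℝ) → ℝ := fun z => f' (P z.1 z.2)
  have hF : ∀ ξ, f' ξ = F (Φ ξ) := fun ξ => by simp only [F, hPΦ]
  have hint : Integrable F ((volume.restrict A).prod (volume.restrict B)) := by
    rw [Measure.prod_restrict]
    have h1 := hf'
    rw [hcube, funext hF] at h1
    exact (hΦ.integrableOn_comp_preimage Φ.measurableEmbedding).1 h1
  have hval : ∫ ξ in openCube (n + 1), f' ξ
      = ∫ y in B, ∫ t in A, F (t, y) := by
    rw [← integral_prod_symm _ hint, Measure.prod_restrict, hcube, funext hF]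
    exact hΦ.setIntegral_preimage_emb Φ.measurableEmbedding F _
  rw [hval]
  -- Lines lying inside the mesh skeleton are discarded: their transverse coordinates lie in
  -- finitely many hyperplanes.
  have hnull : ∀ᵐ y : Fin n → ℝ, ∀ j k, y j ≠ M.brk (i.succAbove j) k := by
    rw [ae_all_iff]
    intro j
    rw [ae_all_iff]
    intro k
    rw [ae_iff]
    simp only [ne_eq, not_not]
    rw [volume_pi]
    exact Measure.pi_hyperplane (α := fun _ : Fin n => ℝ) (fun _ => volume) j _
  have hzero : ∀ᵐ y ∂(volume.restrict B), ∫ t in A, F (t, y) = 0 := by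
    filter_upwards [hint.prod_left_ae, ae_restrict_of_ae hnull,
      ae_restrict_mem (MeasurableSet.univ_pi fun _ => measurableSet_Ioo)] with y hy1 hy2 hy3
    have hclosed : ∀ t ∈ Icc (-1 : ℝ) 1, P t y ∈ closedCube (n + 1) := fun t ht => by
      simp only [closedCube, mem_ofPred_eq]
      rw [Fin.forall_iff_succAbove i]
      exact ⟨by rwa [hPi], fun j => by
        rw [hPs]; exact Ioo_subset_Icc_self (hy3 j (mem_univ _))⟩
    have hPc : Continuous fun t => P t y := by
      refine (PiLp.continuous_toLp 2 _).comp (continuous_pi fun j => ?_)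
      refine Fin.succAboveCases i ?_ (fun j => ?_) j
      · simpa using continuous_id'
      · simpa using continuous_const
    have hle : (-1 : ℝ) ≤ 1 := by norm_num
    have key := MeasureTheory.integral_eq_of_hasDerivAt_off_countable
      (fun t => f (P t y)) (fun t => F (t, y)) (a := -1) (b := 1)
      (s := range (M.brk i)) (countable_range _) ?_ ?_ ?_
    · rw [intervalIntegral.integral_of_le hle, integral_Ioc_eq_integral_Ioo] at key
      rw [key, h0 _ (hclosed 1 (by simp)), h0 _ (hclosed (-1) (by simp)), sub_zero]
      · exact fun h => absurd ((hmem _ _).1 h).1 (by simp [A])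
      · exact fun h => absurd ((hmem _ _).1 h).1 (by simp [A])
    · rw [uIcc_of_le hle]
      exact hf.comp hPc.continuousOn hclosed
    · rw [min_eq_left hle, max_eq_right hle]
      rintro t ⟨ht, htn⟩
      have hbox : P t y ∈ M.boxes := by
        refine M.mem_boxes_of_forall_ne (hclosed t (Ioo_subset_Icc_self ht)) ?_
        rw [Fin.forall_iff_succAbove i]
        refine ⟨fun k => ?_, fun j k => ?_⟩
        · rw [hPi]; exact fun h => htn ⟨k, h.symm⟩
        · rw [hPs]; exact hy2 j k
      -- Moving by r along the basis vector changes only the i-th coordinate, so the line derivative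
      -- is the ordinary derivative in t.
      have h1 : HasDerivAt (fun r : ℝ => f (P t y + r • basisVec i)) (F (t, y)) 0 := hd _ hbox
      have h2 : HasDerivAt (fun r : ℝ => f (P (t + r) y)) (F (t, y)) 0 := by
        refine h1.congr_of_eventuallyEq (Eventually.of_forall fun r => ?_)
        dsimp only
        congr 1
        ext j
        refine Fin.succAboveCases i ?_ (fun j => ?_) j
        · rw [hPi]
          simp [hPi, basisVec]
        · rw [hPs]
          simp [hPs, basisVec, Fin.succAbove_ne]
      have h3 : HasDerivAt _ _ t := HasDerivAt.comp_sub_const t t (by rwa [sub_self])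
      simpa using h3
    · rw [intervalIntegrable_iff_integrableOn_Ioo_of_le hle]
      exact hy1
  rw [integral_congr_ae hzero, integral_zero]

/-! ### Bounded continuous functions on a set -/

section BoundedContinuous

variable {X Y Z W : Type*} [TopologicalSpace X] [NormedAddCommGroup Y] [NormedAddCommGroup Z]
  [NormedAddCommGroup W] {s : Set X}

/-- `f` is continuous and bounded on `s`. -/
def BddContOn (f : X → Y) (s : Set X) : Prop := ContinuousOn f s ∧ ∃ C, ∀ x ∈ s, ‖f x‖ ≤ C

theorem BddContOn.mono {f : X → Y} {t : Set X} (h : BddContOn f s) (hts : t ⊆ s) :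
    BddContOn f t :=
  ⟨h.1.mono hts, h.2.imp fun _ hC x hx => hC x (hts hx)⟩

theorem BddContOn.congr {f g : X → Y} (h : BddContOn f s) (hfg : EqOn g f s) : BddContOn g s :=
  ⟨h.1.congr hfg, h.2.imp fun _ hC x hx => by rw [hfg hx]; exact hC x hx⟩

theorem bddContOn_const (c : Y) : BddContOn (fun _ : X => c) s :=
  ⟨continuousOn_const, ‖c‖, fun _ _ => le_rfl⟩

theorem BddContOn.prodMk {f : X → Y} {g : X → Z} (hf : BddContOn f s) (hg : BddContOn g s) :
    BddContOn (fun x => (f x, g x)) s := by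
  obtain ⟨hf, C, hC⟩ := hf
  obtain ⟨hg, D, hD⟩ := hg
  exact ⟨hf.prodMk hg, max C D, fun x hx => max_le_max (hC x hx) (hD x hx)⟩

theorem BddContOn.comp [ProperSpace Y] {f : X → Y} {g : Y → Z} (hg : Continuous g)
    (hf : BddContOn f s) : BddContOn (fun x => g (f x)) s := by
  obtain ⟨hf, C, hC⟩ := hf
  obtain ⟨D, hD⟩ := (isCompact_closedBall (0 : Y) C).exists_bound_of_continuousOn hg.continuousOn
  exact ⟨hg.comp_continuousOn hf, D, fun x hx => hD _ (by simpa using hC x hx)⟩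

theorem BddContOn.comp₂ [ProperSpace Y] [ProperSpace Z] {f : X → Y} {g : X → Z} {k : Y → Z → W}
    (hk : Continuous fun p : Y × Z => k p.1 p.2) (hf : BddContOn f s) (hg : BddContOn g s) :
    BddContOn (fun x => k (f x) (g x)) s :=
  (hf.prodMk hg).comp hk

theorem BddContOn.add {f g : X → Y} (hf : BddContOn f s) (hg : BddContOn g s) :
    BddContOn (fun x => f x + g x) s := by
  obtain ⟨hf, C, hC⟩ := hf
  obtain ⟨hg, D, hD⟩ := hg
  exact ⟨hf.add hg, C + D, fun x hx => (norm_add_le _ _).trans (add_le_add (hC x hx) (hD x hx))⟩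

theorem BddContOn.neg {f : X → Y} (hf : BddContOn f s) : BddContOn (fun x => -f x) s :=
  ⟨hf.1.neg, hf.2.imp fun _ hC x hx => by rw [norm_neg]; exact hC x hx⟩

theorem BddContOn.sub {f g : X → Y} (hf : BddContOn f s) (hg : BddContOn g s) :
    BddContOn (fun x => f x - g x) s := by
  simpa only [sub_eq_add_neg] using hf.add hg.neg

theorem BddContOn.smul [NormedSpace ℝ Y] {f : X → ℝ} {g : X → Y} (hf : BddContOn f s)
    (hg : BddContOn g s) : BddContOn (fun x => f x • g x) s := by
  obtain ⟨hf, C, hC⟩ := hf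
  obtain ⟨hg, D, hD⟩ := hg
  refine ⟨hf.smul hg, C * D, fun x hx => ?_⟩
  rw [norm_smul]
  exact mul_le_mul (hC x hx) (hD x hx) (norm_nonneg _) ((norm_nonneg _).trans (hC x hx))

theorem BddContOn.mul {f g : X → ℝ} (hf : BddContOn f s) (hg : BddContOn g s) :
    BddContOn (fun x => f x * g x) s := hf.smul hg

theorem BddContOn.sum {ι : Type*} (t : Finset ι) {f : ι → X → Y}
    (hf : ∀ i ∈ t, BddContOn (f i) s) : BddContOn (fun x => ∑ i ∈ t, f i x) s := by
  classical
  induction t using Finset.induction_on with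
  | empty => simpa using bddContOn_const (0 : Y)
  | insert a t ha ih =>
    simp only [Finset.sum_insert ha]
    exact (hf a (by simp)).add (ih fun i hi => hf i (by simp [hi]))

theorem BddContOn.iUnion {ι : Type*} [Finite ι] {s : ι → Set X} {f : X → Y}
    (hs : ∀ i, IsOpen (s i)) (hf : ∀ i, BddContOn f (s i)) : BddContOn f (⋃ i, s i) := by
  refine ⟨ContinuousOn.iUnion_of_isOpen (fun i => (hf i).1) hs, ?_⟩
  choose C hC using fun i => (hf i).2
  obtain ⟨D, hD⟩ := (finite_range C).bddAbove
  refine ⟨D, fun x hx => ?_⟩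
  obtain ⟨i, hi⟩ := mem_iUnion.1 hx
  exact (hC i x hi).trans (hD (mem_range_self i))

theorem _root_.ContinuousOn.bddContOn {f : X → Y} {t : Set X} (hf : ContinuousOn f t) (ht : IsCompact t)
    (hst : s ⊆ t) : BddContOn f s := by
  obtain ⟨C, hC⟩ := ht.exists_bound_of_continuousOn hf
  exact ⟨hf.mono hst, C, fun x hx => hC x (hst hx)⟩

theorem BddContOn.integrableOn {s : Set (Sp d)} {f : Sp d → Y} (hf : BddContOn f s)
    (hs : MeasurableSet s) (hs' : volume s < ⊤) : IntegrableOn f s := by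
  obtain ⟨hf, C, hC⟩ := hf
  have : IsFiniteMeasure (volume.restrict s) := isFiniteMeasure_restrict.2 hs'.ne
  refine Integrable.of_bound (hf.aestronglyMeasurable hs) C ?_
  filter_upwards [ae_restrict_mem hs] with x hx using hC x hx

end BoundedContinuous

theorem bddContOn_inner {X : Type*} [TopologicalSpace X] {s : Set X} {f g : X → Sp d}
    (hf : BddContOn f s) (hg : BddContOn g s) : BddContOn (fun x => ⟪f x, g x⟫_ℝ) s :=
  hf.comp₂ (k := fun a b => ⟪a, b⟫_ℝ) (by fun_prop) hg

namespace GeometryMap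

variable (G : GeometryMap d) (M : KnotMesh d)

theorem integrableOn_domain {Y : Type*} [NormedAddCommGroup Y] {f : Sp d → Y}
    (hf : BddContOn f (G.elems M)) : IntegrableOn f G.domain := by
  unfold IntegrableOn
  rw [Measure.restrict_congr_set (G.domain_ae_eq_elems M)]
  exact hf.integrableOn (G.isOpen_elems M).measurableSet
    ((measure_mono (G.elems_subset_domain M)).trans_lt G.volume_domain_lt_top)

theorem integrableOn_elem {Y : Type*} [NormedAddCommGroup Y] {f : Sp d → Y} {K : M.Elem}
    (hf : BddContOn f (G.elem M K)) : IntegrableOn f (G.elem M K) :=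
  hf.integrableOn (G.isOpen_elem M K).measurableSet
    ((measure_mono (G.elem_subset_domain M K)).trans_lt G.volume_domain_lt_top)

theorem bddContOn_elems {Y : Type*} [NormedAddCommGroup Y] {f : Sp d → Y}
    (hf : ∀ K, BddContOn f (G.elem M K)) : BddContOn f (G.elems M) :=
  BddContOn.iUnion (G.isOpen_elem M) hf

theorem bddContOn_of_continuousOn_closure {Y : Type*} [NormedAddCommGroup Y] {f : Sp d → Y}
    (hf : ContinuousOn f (closure G.domain)) : BddContOn f (G.elems M) :=
  hf.bddContOn G.isCompact_closure_domain ((G.elems_subset_domain M).trans subset_closure)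

variable {M} {K : M.Elem} {Y : Type*} [NormedAddCommGroup Y] [NormedSpace ℝ Y]

theorem contDiffAt_of_closure_elem {n : WithTop ℕ∞} {f : Sp d → Y}
    (hf : ContDiffOn ℝ n f (closure (G.elem M K))) {x : Sp d} (hx : x ∈ G.elem M K) :
    ContDiffAt ℝ n f x :=
  hf.contDiffAt (mem_of_superset ((G.isOpen_elem M K).mem_nhds hx) subset_closure)

theorem fderivWithin_closure_elem (f : Sp d → Y) {x : Sp d} (hx : x ∈ G.elem M K) :
    fderivWithin ℝ f (closure (G.elem M K)) x = fderiv ℝ f x :=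
  fderivWithin_of_mem_nhds (mem_of_superset ((G.isOpen_elem M K).mem_nhds hx) subset_closure)

theorem bddContOn_fderiv {f : Sp d → Y} (hf : ContDiffOn ℝ 1 f (closure (G.elem M K))) :
    BddContOn (fderiv ℝ f) (G.elem M K) :=
  ((hf.continuousOn_fderivWithin (G.uniqueDiffOn_closure_elem M K) le_rfl).bddContOn
    (G.isCompact_closure_elem M K) subset_closure).congr
    fun _ hx => (G.fderivWithin_closure_elem f hx).symm

theorem bddContOn_elem {n : WithTop ℕ∞} {f : Sp d → Y}
    (hf : ContDiffOn ℝ n f (closure (G.elem M K))) : BddContOn f (G.elem M K) :=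
  hf.continuousOn.bddContOn (G.isCompact_closure_elem M K) subset_closure

end GeometryMap

/-! ### Divergence of discrete velocities -/

theorem gradient_inner (g : Sp d → ℝ) (x w : Sp d) : ⟪w, gradient g x⟫_ℝ = fderiv ℝ g x w := by
  rw [real_inner_comm, gradient, InnerProductSpace.toDual_symm_apply]

theorem divergence_smul {η : Sp d → ℝ} {w : Sp d → Sp d} {x : Sp d}
    (hη : DifferentiableAt ℝ η x) (hw : DifferentiableAt ℝ w x) :
    divergence (fun z => η z • w z) x = η x * divergence w x + fderiv ℝ η x (w x) := by
  have e : fderiv ℝ η x (w x) = ∑ i, w x i * fderiv ℝ η x (basisVec i) := by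
    conv_lhs => rw [← sum_smul_basisVec (w x)]
    simp [map_sum]
  unfold divergence
  rw [e, fderiv_fun_smul hη hw, Finset.mul_sum, ← Finset.sum_add_distrib]
  refine Finset.sum_congr rfl fun i _ => ?_
  simp [mul_comm]

/-- Each partial derivative is integrated by parts against the constant function 1. -/
theorem integral_divergence_eq_zero {h : Sp d → Sp d} (hh : ContDiff ℝ 1 h)
    (hs : HasCompactSupport h) : ∫ x, divergence h x = 0 := by
  have hint : ∀ i, Integrable fun x => fderiv ℝ h x (basisVec i) := fun i =>
    ((hh.continuous_fderiv (by norm_num)).clm_apply continuous_const).integrable_of_hasCompactSupport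
      ((hs.fderiv ℝ).comp_left (g := fun A : Sp d →L[ℝ] Sp d => A (basisVec i)) (by simp))
  have hz : ∀ i, ∫ x, fderiv ℝ h x (basisVec i) = 0 := fun i => by
    have := integral_smul_fderiv_eq_neg_fderiv_smul_of_integrable (μ := volume)
      (f := fun _ : Sp d => (1 : ℝ)) (g := h) (v := basisVec i) (by simp) (by simpa using hint i)
      (by simpa using hh.continuous.integrable_of_hasCompactSupport hs) (by simp)
      (fun x _ => hh.differentiable (by norm_num) x)
    simpa using this
  unfold divergence
  have hint' : ∀ i, Integrable fun x => fderiv ℝ h x (basisVec i) i := fun i =>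
    (EuclideanSpace.proj i : Sp d →L[ℝ] ℝ).integrable_comp (hint i)
  rw [integral_finsetSum _ fun i _ => hint' i]
  refine Finset.sum_eq_zero fun i _ => ?_
  have := (EuclideanSpace.proj i : Sp d →L[ℝ] ℝ).integral_comp_comm (hint i)
  rw [hz i, map_zero] at this
  exact this

/-- A parametric velocity together with the derivatives that make up its parametric divergence. -/
structure PiolaData (G : GeometryMap d) {M : KnotMesh d} (σ : SplineType M) (w : Sp d → Sp d) where
  comp : Fin d → Sp d → ℝ
  comp_mem : ∀ i, comp i ∈ tensorSpline M (σ.raise i)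
  der : Fin d → Sp d → ℝ
  der_mem : ∀ i, der i ∈ tensorSpline M σ
  hasLineDerivAt : ∀ i, ∀ ξ ∈ M.boxes, HasLineDerivAt ℝ (comp i) (der i ξ) ξ (basisVec i)
  apply_toFun : ∀ ξ ∈ closedCube d,
    w (G.toFun ξ) = (G.jac ξ).det⁻¹ • G.jac ξ (WithLp.toLp 2 fun i => comp i ξ)
  comp_eq_zero : ∀ i, ∀ ξ ∈ closedCube d, ξ ∉ openCube d → comp i ξ = 0

/-- F maps the boundary of the cube into ∂Ω, where w = 0. As J is injective, every parametric
component vanishes there, not only the normal one. -/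
theorem exists_piolaData {G : GeometryMap d} {M : KnotMesh d} {σ : SplineType M} {w : Sp d → Sp d}
    (hw : w ∈ G.velocitySpace M σ) : Nonempty (PiolaData G σ w) := by
  obtain ⟨⟨c, hc, hval⟩, h0, -⟩ := hw
  choose c' hc' hd using fun i => exists_lineDeriv_mem_tensorSpline (hc i)
  refine ⟨⟨c, hc, c', hc', hd, hval, fun i ξ hξ hξ' => ?_⟩⟩
  have h1 := hval ξ hξ
  rw [h0 _ (G.toFun_mem_frontier hξ hξ')] at h1
  have h2 := (smul_eq_zero.1 h1.symm).resolve_left (inv_ne_zero (G.det_jac_ne_zero hξ))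
  rw [← map_zero (G.jac ξ)] at h2
  have h3 := congrArg (fun z : Sp d => z i) (G.jac_injective hξ h2)
  simpa using h3

namespace PiolaData

variable {G : GeometryMap d} {M : KnotMesh d} {σ : SplineType M} {w : Sp d → Sp d}
  (P : PiolaData G σ w)

/-- The parametric divergence. -/
def paramDiv (ξ : Sp d) : ℝ := ∑ i, P.der i ξ

/-- The physical divergence, extended continuously to the closed domain. -/
def div (x : Sp d) : ℝ := (G.jac (G.inv x)).det⁻¹ * P.paramDiv (G.inv x)

theorem paramDiv_mem : P.paramDiv ∈ tensorSpline M σ := by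
  have : P.paramDiv = ∑ i, P.der i := by ext ξ; simp [paramDiv]
  rw [this]
  exact Submodule.sum_mem _ fun i _ => P.der_mem i

theorem div_toFun {ξ : Sp d} (hξ : ξ ∈ closedCube d) :
    P.div (G.toFun ξ) = (G.jac ξ).det⁻¹ * P.paramDiv ξ := by
  rw [div, G.inv_toFun hξ]

theorem continuousOn_div : ContinuousOn P.div (closure G.domain) := by
  have h1 : ContinuousOn (fun ξ => (G.jac ξ).det⁻¹ * P.paramDiv ξ) (closedCube d) :=
    (G.continuousOn_det_jac.inv₀ fun ξ hξ => G.det_jac_ne_zero hξ).mul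
      (continuousOn_tensorSpline P.paramDiv_mem)
  exact h1.comp G.continuousOn_inv fun x hx => G.inv_mem hx

include P in
theorem continuousOn_comp_toFun : ContinuousOn (fun ξ => w (G.toFun ξ)) (closedCube d) := by
  refine ContinuousOn.congr ?_ P.apply_toFun
  refine (G.continuousOn_det_jac.inv₀ fun ξ hξ => G.det_jac_ne_zero hξ).smul
    (G.continuousOn_jac.clm_apply ?_)
  exact (PiLp.continuous_toLp 2 _).comp_continuousOn
    (continuousOn_pi.2 fun i => continuousOn_tensorSpline (P.comp_mem i))

/-- This is the weak Piola identity. Only J itself enters, never its derivatives, and g need only be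
continuous with bounded continuous elementwise derivative, because the integration by parts
tolerates kinks on the skeleton. -/
theorem integral_fderiv_apply {g : Sp d → ℝ}
    (hg : ContinuousOn (fun ξ => g (G.toFun ξ)) (closedCube d))
    (hd : ∀ x ∈ G.elems M, DifferentiableAt ℝ g x) (hb : BddContOn (fderiv ℝ g) (G.elems M)) :
    ∫ x in G.domain, fderiv ℝ g x (w x) = -∫ x in G.domain, P.div x * g x := by
  obtain ⟨s, hs⟩ := G.exists_sign_det
  have hmaps : ∀ ξ ∈ M.boxes, G.toFun ξ ∈ G.elems M := fun ξ hξ => by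
    rw [G.elems_eq]; exact mem_image_of_mem _ hξ
  have hbc : M.boxes ⊆ closedCube d := M.boxes_subset_openCube.trans openCube_subset
  have hA : ∀ i, BddContOn (fun ξ => P.comp i ξ * fderiv ℝ g (G.toFun ξ) (G.jac ξ (basisVec i)))
      M.boxes := fun i => by
    have h1 : BddContOn (fun ξ => fderiv ℝ g (G.toFun ξ)) M.boxes :=
      ⟨hb.1.comp (G.continuousOn_toFun.mono hbc) hmaps,
        hb.2.imp fun C hC ξ hξ => hC _ (hmaps ξ hξ)⟩
    have h2 : BddContOn (fun ξ => G.jac ξ (basisVec i)) M.boxes :=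
      (G.continuousOn_jac.clm_apply continuousOn_const).bddContOn isCompact_closedCube hbc
    have h3 : BddContOn (P.comp i) M.boxes :=
      (continuousOn_tensorSpline (P.comp_mem i)).bddContOn isCompact_closedCube hbc
    exact h3.mul (h1.comp₂ (k := fun A v => A v) (by fun_prop) h2)
  have hfin : volume (openCube d) < ⊤ :=
    (measure_mono openCube_subset).trans_lt isCompact_closedCube.measure_lt_top
  have hAi : ∀ i, IntegrableOn
      (fun ξ => P.comp i ξ * fderiv ℝ g (G.toFun ξ) (G.jac ξ (basisVec i))) (openCube d) :=
    fun i => by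
      have hae : openCube d =ᵐ[volume] M.boxes :=
        (ae_le_set.2 M.volume_openCube_diff_boxes).antisymm
          (LE.le.eventuallyLE M.boxes_subset_openCube)
      unfold IntegrableOn
      rw [Measure.restrict_congr_set hae]
      exact (hA i).integrableOn M.isOpen_boxes.measurableSet
        ((measure_mono M.boxes_subset_openCube).trans_lt hfin)
  have hBi : ∀ i, IntegrableOn (fun ξ => P.der i ξ * g (G.toFun ξ)) (openCube d) := fun i =>
    (((continuousOn_tensorSpline (P.der_mem i)).mul hg).integrableOn_compact
      isCompact_closedCube).mono_set openCube_subset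
  have hzero : ∀ i, ∫ ξ in openCube d, (P.comp i ξ * fderiv ℝ g (G.toFun ξ) (G.jac ξ (basisVec i))
      + P.der i ξ * g (G.toFun ξ)) = 0 := fun i => by
    refine integral_lineDeriv_openCube_eq_zero (M := M) i
      (f := fun ξ => P.comp i ξ * g (G.toFun ξ))
      ((continuousOn_tensorSpline (P.comp_mem i)).mul hg)
      (fun ξ h1 h2 => by simp [P.comp_eq_zero i ξ h1 h2]) ((hAi i).add (hBi i)) fun ξ hξ => ?_
    have h1 := P.hasLineDerivAt i ξ hξ
    have h2 : HasLineDerivAt ℝ (fun ξ => g (G.toFun ξ))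
        (fderiv ℝ g (G.toFun ξ) (G.jac ξ (basisVec i))) ξ (basisVec i) :=
      (((hd _ (hmaps ξ hξ)).hasFDerivAt.comp ξ
        (G.hasFDerivAt (M.boxes_subset_openCube hξ))).hasLineDerivAt (basisVec i) :)
    have h3 := HasDerivAt.mul h1 h2
    refine h3.congr_deriv ?_
    simp
    ring
  have hl : ∫ x in G.domain, fderiv ℝ g x (w x) = s * ∫ ξ in openCube d,
      ∑ i, P.comp i ξ * fderiv ℝ g (G.toFun ξ) (G.jac ξ (basisVec i)) := by
    rw [G.integral_domain, ← integral_const_mul]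
    refine setIntegral_congr_fun isOpen_openCube.measurableSet fun ξ hξ => ?_
    have hξ' := openCube_subset hξ
    -- Here |det J| (det J)⁻¹ = s, and ∇g · Jŵ = ∑ ŵ_i ∂_i(g ∘ F).
    rw [hs ξ hξ', P.apply_toFun ξ hξ', map_smul, smul_eq_mul,
      ← sum_smul_basisVec (WithLp.toLp 2 fun i => P.comp i ξ)]
    have := G.det_jac_ne_zero hξ'
    simp only [map_sum, map_smul, smul_eq_mul]
    field_simp
  have hr : ∫ x in G.domain, P.div x * g x = s * ∫ ξ in openCube d,
      ∑ i, P.der i ξ * g (G.toFun ξ) := by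
    rw [G.integral_domain, ← integral_const_mul]
    refine setIntegral_congr_fun isOpen_openCube.measurableSet fun ξ hξ => ?_
    have hξ' := openCube_subset hξ
    have := G.det_jac_ne_zero hξ'
    rw [hs ξ hξ', P.div_toFun hξ', paramDiv, ← Finset.sum_mul]
    field_simp
  rw [hl, hr, integral_finsetSum _ fun i _ => hAi i, integral_finsetSum _ fun i _ => hBi i,
    ← mul_neg, ← Finset.sum_neg_distrib]
  congr 1
  refine Finset.sum_congr rfl fun i _ => ?_
  have := hzero i
  rw [integral_add (hAi i) (hBi i)] at this
  linarith

theorem div_mem_pressureSpace : P.div ∈ G.pressureSpace M σ := by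
  refine ⟨⟨P.paramDiv, P.paramDiv_mem, fun ξ hξ => P.div_toFun hξ⟩, ?_⟩
  -- Testing with a constant gives the zero average.
  have := P.integral_fderiv_apply (g := fun _ => 1) continuousOn_const
    (fun _ _ => differentiableAt_const _) (by
      refine (bddContOn_const (0 : Sp d →L[ℝ] ℝ)).congr fun x _ => ?_
      simp)
  simpa using this

/-- Both functions are weak divergences of w inside one element, one by the Piola identity and the
other classically since w is C¹ there. The fundamental lemma of the calculus of variations
identifies them almost everywhere, and continuity does so at every point. -/
theorem divergence_eq (hw : w ∈ G.velocitySpace M σ) {x : Sp d} (hx : x ∈ G.elems M) :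
    divergence w x = P.div x := by
  obtain ⟨K, hK⟩ := mem_iUnion.1 hx
  have hsm := hw.2.2 K
  have hfd := G.bddContOn_fderiv hsm
  have hdiv : BddContOn (divergence w) (G.elem M K) := by
    refine BddContOn.sum _ fun i _ => ?_
    exact hfd.comp (g := fun A : Sp d →L[ℝ] Sp d => (A (basisVec i)) i) (by fun_prop)
  have hsub : G.elem M K ⊆ closure G.domain := (G.elem_subset_domain M K).trans subset_closure
  have hP : BddContOn P.div (G.elem M K) :=
    P.continuousOn_div.bddContOn G.isCompact_closure_domain hsub
  have hopen := G.isOpen_elem M K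
  have hae : ∀ᵐ y : Sp d, y ∈ G.elem M K → divergence w y - P.div y = 0 := by
    refine hopen.ae_eq_zero_of_integral_contDiff_smul_eq_zero
      (G.integrableOn_elem M (hdiv.sub hP)).locallyIntegrableOn fun η hη hηc hηs => ?_
    have hη1 : ContDiff ℝ 1 η := hη.of_le (by exact_mod_cast le_top)
    have hz : ∀ y ∉ G.elem M K, η y = 0 := fun y hy =>
      image_eq_zero_of_notMem_tsupport fun h => hy (hηs h)
    have hz' : ∀ y ∉ G.elem M K, fderiv ℝ η y = 0 := fun y hy =>
      image_eq_zero_of_notMem_tsupport fun h => hy (hηs (tsupport_fderiv_subset ℝ h))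
    have hbη : BddContOn η (G.elem M K) :=
      hη.continuous.continuousOn.bddContOn (G.isCompact_closure_elem M K) subset_closure
    have hbη' : BddContOn (fderiv ℝ η) (G.elem M K) :=
      (hη1.continuous_fderiv (by norm_num)).continuousOn.bddContOn
        (G.isCompact_closure_elem M K) subset_closure
    have h1 : ∫ y in G.elem M K, fderiv ℝ η y (w y) = -∫ y in G.elem M K, P.div y * η y := by
      have := P.integral_fderiv_apply (g := η)
        (hη.continuous.comp_continuousOn G.continuousOn_toFun)
        (fun y _ => hη1.differentiable (by norm_num) y)
        ((hη1.continuous_fderiv (by norm_num)).continuousOn.bddContOn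
          G.isCompact_closure_domain ((G.elems_subset_domain M).trans subset_closure))
      rwa [setIntegral_eq_of_subset_of_forall_sdiff_eq_zero G.isOpen_domain.measurableSet
          (G.elem_subset_domain M K) fun y hy => by simp [hz' y hy.2],
        setIntegral_eq_of_subset_of_forall_sdiff_eq_zero G.isOpen_domain.measurableSet
          (G.elem_subset_domain M K) fun y hy => by simp [hz y hy.2]] at this
    -- Although w is C¹ only inside the element, the product is C¹ on all of space because it
    -- vanishes near every point outside the support of η.
    have hcd : ContDiff ℝ 1 (fun y => η y • w y) := by
      refine contDiff_iff_contDiffAt.2 fun y => ?_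
      by_cases hy : y ∈ tsupport η
      · exact hη1.contDiffAt.smul (G.contDiffAt_of_closure_elem hsm (hηs hy))
      · refine (contDiffAt_const (c := (0 : Sp d))).congr_of_eventuallyEq ?_
        filter_upwards [notMem_tsupport_iff_eventuallyEq.1 hy] with z hz
        simp [hz]
    have h2 : ∫ y in G.elem M K, (η y * divergence w y + fderiv ℝ η y (w y)) = 0 := by
      rw [← integral_divergence_eq_zero hcd hηc.smul_right,
        ← setIntegral_eq_integral_of_forall_compl_eq_zero (s := G.elem M K)
          (f := divergence fun y => η y • w y)]
      · refine setIntegral_congr_fun hopen.measurableSet fun y hy => ?_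
        exact (divergence_smul (hη1.differentiable (by norm_num) y)
          ((G.contDiffAt_of_closure_elem hsm hy).differentiableAt (by norm_num))).symm
      · intro y hy
        have : fderiv ℝ (fun y => η y • w y) y = 0 :=
          image_eq_zero_of_notMem_tsupport fun h =>
            hy (hηs (tsupport_smul_subset_left _ _ (tsupport_fderiv_subset ℝ h)))
        simp [divergence, this]
    rw [← setIntegral_eq_integral_of_forall_compl_eq_zero (s := G.elem M K)
      fun y hy => by simp [hz y hy]]
    have hi1 := G.integrableOn_elem M (hbη.mul hdiv)
    have hi2 := G.integrableOn_elem M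
      (hbη'.comp₂ (k := fun A v => A v) (by fun_prop) (G.bddContOn_elem hsm))
    have hi3 := G.integrableOn_elem M (hP.mul hbη)
    rw [integral_add hi1 hi2, h1] at h2
    simp only [smul_eq_mul, mul_sub]
    rw [integral_sub hi1 (hi3.congr (ae_of_all _ fun _ => mul_comm _ _))]
    simp only [mul_comm (η _) (P.div _)]
    linarith
  have := Measure.eqOn_open_of_ae_eq (μ := (volume : Measure (Sp d)))
    (f := divergence w) (g := P.div) (U := G.elem M K) (by
      filter_upwards [ae_restrict_of_ae hae, ae_restrict_mem hopen.measurableSet] with y h1 h2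
      exact sub_eq_zero.1 (h1 h2)) hopen hdiv.1 hP.1
  exact this hK

/-- The choice q = `P.div` is allowed and turns the continuity equation into ∫ `P.div`² = 0.
Continuity on the closure upgrades almost everywhere to everywhere, boundary included. -/
theorem div_eq_zero (hw : w ∈ G.velocitySpace M σ)
    (hq : ∀ q ∈ G.pressureSpace M σ, ∫ x in G.domain, q x * divergence w x = 0) {x : Sp d}
    (hx : x ∈ closure G.domain) : P.div x = 0 := by
  have hb : BddContOn P.div (G.elems M) := G.bddContOn_of_continuousOn_closure M P.continuousOn_div
  have h1 : ∫ x in G.domain, P.div x * P.div x = 0 := by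
    rw [← hq _ P.div_mem_pressureSpace]
    exact G.setIntegral_domain_congr M fun x hx => by rw [P.divergence_eq hw hx]
  rw [integral_eq_zero_iff_of_nonneg (fun x => mul_self_nonneg _)
    (G.integrableOn_domain M (hb.mul hb))] at h1
  have h2 : EqOn P.div 0 G.domain := by
    refine Measure.eqOn_open_of_ae_eq (μ := (volume : Measure (Sp d))) ?_ G.isOpen_domain
      (P.continuousOn_div.mono subset_closure) continuousOn_const
    filter_upwards [h1] with x hx
    simpa using hx
  exact h2.of_subset_closure P.continuousOn_div continuousOn_const subset_closure Subset.rfl hx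

end PiolaData

/-! ### Membership in the discrete spaces -/

theorem bddContOn_gradient {s : Set (Sp d)} {f : Sp d → ℝ} (h : BddContOn (fderiv ℝ f) s) :
    BddContOn (gradient f) s :=
  BddContOn.comp (g := fun A => (InnerProductSpace.toDual ℝ (Sp d)).symm A)
    (InnerProductSpace.toDual ℝ (Sp d)).symm.continuous h

namespace GeometryMap

variable (G : GeometryMap d) {M : KnotMesh d} {σ : SplineType M} {N : NurbsType M}

theorem closure_elem_subset (K : M.Elem) : closure (G.elem M K) ⊆ closure G.domain :=
  closure_mono (G.elem_subset_domain M K)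

/-- Membership depends only on values on the closure of Ω, so agreement there with a combination
suffices. Time slices of trial functions become admissible test functions in this way. -/
theorem sum_mem_velocitySpace {ι : Type*} [Fintype ι] {f : Sp d → Sp d} (a : ι → ℝ)
    {B : ι → Sp d → Sp d} (hB : ∀ i, B i ∈ G.velocitySpace M σ)
    (hf : ∀ x ∈ closure G.domain, f x = ∑ i, a i • B i x) : f ∈ G.velocitySpace M σ := by
  choose c hc hval using fun i => (hB i).1
  refine ⟨⟨fun j => ∑ i, a i • c i j, fun j => ?_, fun ξ hξ => ?_⟩, fun x hx => ?_, fun K => ?_⟩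
  · exact Submodule.sum_mem _ fun i _ => Submodule.smul_mem _ _ (hc i j)
  · rw [hf _ (by rw [G.closure_domain]; exact mem_image_of_mem _ hξ)]
    have e : (WithLp.toLp 2 fun j => (∑ i, a i • c i j) ξ : Sp d)
        = ∑ i, a i • (WithLp.toLp 2 fun j => c i j ξ : Sp d) := by
      ext j; simp
    rw [e, map_sum, Finset.smul_sum]
    refine Finset.sum_congr rfl fun i _ => ?_
    rw [hval i ξ hξ, map_smul, smul_comm]
  · rw [hf x (frontier_subset_closure hx)]
    exact Finset.sum_eq_zero fun i _ => by rw [(hB i).2.1 x hx, smul_zero]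
  · exact (ContDiffOn.sum (f := fun i x => a i • B i x) fun i _ => ContDiffOn.smul (f := fun _ => a i) contDiffOn_const
      ((hB i).2.2 K)).congr
      fun x hx => hf x (G.closure_elem_subset K hx)

theorem sum_mem_scalarSpace {ι : Type*} [Fintype ι] {f : Sp d → ℝ} (a : ι → ℝ)
    {B : ι → Sp d → ℝ} (hB : ∀ i, B i ∈ G.scalarSpace M N)
    (hf : ∀ x ∈ closure G.domain, f x = ∑ i, a i • B i x) : f ∈ G.scalarSpace M N := by
  choose c hc hval using hB
  refine ⟨∑ i, a i • c i, Submodule.sum_mem _ fun i _ => Submodule.smul_mem _ _ (hc i),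
    fun ξ hξ => ?_⟩
  rw [hf _ (by rw [G.closure_domain]; exact mem_image_of_mem _ hξ)]
  simp only [Finset.sum_apply, Pi.smul_apply, smul_eq_mul, Finset.sum_div, hval _ ξ hξ]
  exact Finset.sum_congr rfl fun i _ => by ring

theorem continuousOn_comp_of_mem_scalarSpace {f : Sp d → ℝ} (hf : f ∈ G.scalarSpace M N) :
    ContinuousOn (fun ξ => f (G.toFun ξ)) (closedCube d) := by
  obtain ⟨c, hc, hval⟩ := hf
  exact ((continuousOn_tensorSpline hc).div (continuousOn_tensorSpline N.weight_mem)
    fun ξ hξ => (N.weight_pos ξ hξ).ne').congr hval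

theorem bddContOn_of_mem_scalarSpace {f : Sp d → ℝ} (hf : f ∈ G.scalarSpace M N) :
    BddContOn f (G.elems M) := by
  refine G.bddContOn_of_continuousOn_closure M ?_
  refine ((G.continuousOn_comp_of_mem_scalarSpace hf).comp G.continuousOn_inv
    fun x hx => G.inv_mem hx).congr fun x hx => ?_
  simp [G.toFun_inv hx]

theorem bddContOn_of_mem_velocitySpace {f : Sp d → Sp d} (hf : f ∈ G.velocitySpace M σ) :
    BddContOn f (G.elems M) :=
  G.bddContOn_elems M fun K => G.bddContOn_elem (hf.2.2 K)

/-- On an element f is a smooth quotient composed with F⁻¹, and DF⁻¹ = J⁻¹ is continuous up to the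
boundary. This is needed for the basis functions and for ∂ₜφ, which carry no smoothness assumption
of their own. -/
theorem fderiv_of_mem_scalarSpace {f : Sp d → ℝ} (hf : f ∈ G.scalarSpace M N) :
    (∀ x ∈ G.elems M, DifferentiableAt ℝ f x) ∧ BddContOn (fderiv ℝ f) (G.elems M) := by
  have key : ∀ K : M.Elem, (∀ x ∈ G.elem M K, DifferentiableAt ℝ f x) ∧
      BddContOn (fderiv ℝ f) (G.elem M K) := by
    intro K
    obtain ⟨c, hc, hval⟩ := hf
    obtain ⟨gc, hgc, hc'⟩ := exists_contDiff_eqOn_closedBox hc K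
    obtain ⟨gw, hgw, hw'⟩ := exists_contDiff_eqOn_closedBox N.weight_mem K
    have hsub := M.closedBox_subset K
    have hopen : IsOpen {ξ | gw ξ ≠ 0} := isOpen_ne_fun hgw.continuous continuous_const
    have hne : M.closedBox K ⊆ {ξ | gw ξ ≠ 0} := fun ξ hξ => by
      rw [mem_ofPred_eq, ← hw' hξ]; exact (N.weight_pos ξ (hsub hξ)).ne'
    have hg : ContDiffOn ℝ 1 (fun ξ => gc ξ / gw ξ) {ξ | gw ξ ≠ 0} :=
      (hgc.of_le (by exact_mod_cast le_top)).contDiffOn.div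
        (hgw.of_le (by exact_mod_cast le_top)).contDiffOn fun ξ hξ => hξ
    have hfd : ∀ x ∈ G.elem M K, HasFDerivAt f
        ((fderiv ℝ (fun ξ => gc ξ / gw ξ) (G.inv x)).comp (G.jac (G.inv x)).inverse) x := by
      rintro _ ⟨ξ, hξ, rfl⟩
      have hξ1 := M.box_subset_closedBox K hξ
      rw [G.inv_toFun (hsub hξ1)]
      have h1 := ((hg.contDiffAt (hopen.mem_nhds (hne hξ1))).differentiableAt
        (by norm_num)).hasFDerivAt
      rw [← G.inv_toFun (hsub hξ1)] at h1
      have h2 := h1.comp (G.toFun ξ) (G.hasFDerivAt_inv (M.box_subset_openCube K hξ))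
      rw [G.inv_toFun (hsub hξ1)] at h2
      refine h2.congr_of_eventuallyEq ?_
      filter_upwards [(G.isOpen_elem M K).mem_nhds (mem_image_of_mem _ hξ)] with y hy
      obtain ⟨η, hη, rfl⟩ := hy
      have hη1 := M.box_subset_closedBox K hη
      rw [hval η (hsub hη1), Function.comp_apply, G.inv_toFun (hsub hη1), hc' hη1, hw' hη1]
    refine ⟨fun x hx => (hfd x hx).differentiableAt, ?_⟩
    refine BddContOn.congr ?_ fun x hx => (hfd x hx).fderiv
    have hinv : MapsTo G.inv (closure (G.elem M K)) (M.closedBox K) := fun x hx => by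
      rw [G.closure_elem] at hx
      obtain ⟨ξ, hξ, rfl⟩ := hx
      rwa [G.inv_toFun (hsub hξ)]
    have hinvc : ContinuousOn G.inv (closure (G.elem M K)) :=
      G.continuousOn_inv.mono (G.closure_elem_subset K)
    refine ContinuousOn.bddContOn ?_ (G.isCompact_closure_elem M K) subset_closure
    exact (((hg.continuousOn_fderiv_of_isOpen hopen le_rfl).mono hne).comp hinvc hinv).clm_comp
      ((G.continuousOn_inverse_jac.mono hsub).comp hinvc hinv)
  refine ⟨fun x hx => ?_, G.bddContOn_elems M fun K => (key K).2⟩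
  obtain ⟨K, hK⟩ := mem_iUnion.1 hx
  exact (key K).1 x hK

/-! ### Time derivatives of trial functions -/

variable {T : ℝ}

theorem bddContOn_time {X : Type*} [TopologicalSpace X] {S : Set X} {c : ℝ → ℝ} {J : Set ℝ}
    (hJ : IsCompact J) (hc : ContinuousOn c J) : BddContOn (fun z : ℝ × X => c z.1) (J ×ˢ S) := by
  obtain ⟨C, hC⟩ := hJ.exists_bound_of_continuousOn hc
  exact ⟨hc.comp continuousOn_fst fun _ hz => hz.1, C, fun z hz => hC _ hz.1⟩

theorem bddContOn_space {X Y : Type*} [TopologicalSpace X] [NormedAddCommGroup Y] {S : Set X}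
    {f : X → Y} {J : Set ℝ} (hf : BddContOn f S) : BddContOn (fun z : ℝ × X => f z.2) (J ×ˢ S) :=
  ⟨hf.1.comp continuousOn_snd fun _ hz => hz.2, hf.2.imp fun _ hC _ hz => hC _ hz.2⟩

theorem bddContOn_slice {X Y : Type*} [TopologicalSpace X] [NormedAddCommGroup Y] {S : Set X}
    {f : ℝ × X → Y} {J : Set ℝ} {t : ℝ} (hf : BddContOn f (J ×ˢ S)) (ht : t ∈ J) :
    BddContOn (fun x => f (t, x)) S :=
  ⟨hf.1.comp (by fun_prop) fun x hx => ⟨ht, hx⟩, hf.2.imp fun _ hC x hx => hC _ ⟨ht, hx⟩⟩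

theorem exists_timeDeriv_velocity {u : ℝ → Sp d → Sp d}
    (hu : u ∈ G.trialSpace (G.velocitySpace M σ) T) :
    (∀ t ∈ Ioo 0 T, u t ∈ G.velocitySpace M σ) ∧
    ∃ ut : ℝ → Sp d → Sp d,
      (∀ t ∈ Ioo 0 T, ∀ x ∈ closure G.domain, HasDerivAt (fun s => u s x) (ut t x) t) ∧
      ∀ J ⊆ Ioo 0 T, IsCompact J →
        BddContOn (fun z : ℝ × Sp d => u z.1 z.2) (J ×ˢ G.elems M) ∧
        BddContOn (fun z : ℝ × Sp d => ut z.1 z.2) (J ×ˢ G.elems M) := by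
  obtain ⟨m, c, B, hB, hc, hu⟩ := hu
  have hsub : G.elems M ⊆ closure G.domain := (G.elems_subset_domain M).trans subset_closure
  refine ⟨fun t ht => G.sum_mem_velocitySpace (fun i => c i t) hB (hu t ht),
    fun t x => ∑ i, deriv (c i) t • B i x, fun t ht x hx => ?_, fun J hJ hJc => ⟨?_, ?_⟩⟩
  · refine HasDerivAt.congr_of_eventuallyEq (f := fun s => ∑ i, c i s • B i x) ?_ ?_
    · exact HasDerivAt.fun_sum fun i _ => (((hc i).differentiableOn (by norm_num) t
        ht).differentiableAt (Ioo_mem_nhds ht.1 ht.2)).hasDerivAt.smul_const _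
    · filter_upwards [Ioo_mem_nhds ht.1 ht.2] with s hs using hu s hs x hx
  · refine BddContOn.congr ?_ fun z hz => hu z.1 (hJ hz.1) z.2 (hsub hz.2)
    exact BddContOn.sum _ fun i _ => (bddContOn_time hJc ((hc i).continuousOn.mono hJ)).smul
      (bddContOn_space (G.bddContOn_of_mem_velocitySpace (hB i)))
  · exact BddContOn.sum _ fun i _ => (bddContOn_time hJc
      (((hc i).continuousOn_deriv_of_isOpen isOpen_Ioo le_rfl).mono hJ)).smul
      (bddContOn_space (G.bddContOn_of_mem_velocitySpace (hB i)))

/-- In a finite sum ∑ c_i(t) B_i(x) time and space separate: ∂ₜφ stays in the space, ∂ₜ commutes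
with ∇, and all bounds are uniform over compact time sets. -/
theorem exists_timeDeriv_scalar {φ : ℝ → Sp d → ℝ}
    (hφ : φ ∈ G.trialSpace (G.scalarSpace M N) T) :
    (∀ t ∈ Ioo 0 T, φ t ∈ G.scalarSpace M N) ∧
    ∃ φt : ℝ → Sp d → ℝ,
      (∀ t ∈ Ioo 0 T, φt t ∈ G.scalarSpace M N) ∧
      (∀ t ∈ Ioo 0 T, ∀ x ∈ closure G.domain, HasDerivAt (fun s => φ s x) (φt t x) t) ∧
      (∀ t ∈ Ioo 0 T, ∀ x ∈ G.elems M,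
        HasDerivAt (fun s => gradient (φ s) x) (gradient (φt t) x) t) ∧
      ∀ J ⊆ Ioo 0 T, IsCompact J →
        BddContOn (fun z : ℝ × Sp d => φ z.1 z.2) (J ×ˢ G.elems M) ∧
        BddContOn (fun z : ℝ × Sp d => φt z.1 z.2) (J ×ˢ G.elems M) ∧
        BddContOn (fun z : ℝ × Sp d => gradient (φ z.1) z.2) (J ×ˢ G.elems M) ∧
        BddContOn (fun z : ℝ × Sp d => gradient (φt z.1) z.2) (J ×ˢ G.elems M) := by
  obtain ⟨m, c, B, hB, hc, hφ⟩ := hφ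
  have hsub : G.elems M ⊆ closure G.domain := (G.elems_subset_domain M).trans subset_closure
  have hgrad : ∀ (a : Fin m → ℝ), ∀ x ∈ G.elems M,
      gradient (fun y => ∑ i, a i • B i y) x = ∑ i, a i • gradient (B i) x := fun a x hx => by
    have h1 : HasFDerivAt (fun y => ∑ i, a i • B i y) (∑ i, a i • fderiv ℝ (B i) x) x :=
      HasFDerivAt.fun_sum fun i _ =>
        ((G.fderiv_of_mem_scalarSpace (hB i)).1 x hx).hasFDerivAt.const_smul (a i)
    rw [gradient, h1.fderiv, map_sum]
    simp [gradient]
  have hgradφ : ∀ t ∈ Ioo 0 T, ∀ x ∈ G.elems M,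
      gradient (φ t) x = ∑ i, c i t • gradient (B i) x := fun t ht x hx => by
    rw [← hgrad _ x hx, gradient, gradient]
    congr 1
    refine Filter.EventuallyEq.fderiv_eq ?_
    filter_upwards [(G.isOpen_elems M).mem_nhds hx] with y hy using hφ t ht y (hsub hy)
  have hcd : ∀ i, ContinuousOn (deriv (c i)) (Ioo 0 T) := fun i =>
    (hc i).continuousOn_deriv_of_isOpen isOpen_Ioo le_rfl
  have hcder : ∀ i, ∀ t ∈ Ioo 0 T, HasDerivAt (c i) (deriv (c i) t) t := fun i t ht =>
    (((hc i).differentiableOn (by norm_num) t ht).differentiableAt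
      (Ioo_mem_nhds ht.1 ht.2)).hasDerivAt
  refine ⟨fun t ht => G.sum_mem_scalarSpace (fun i => c i t) hB (hφ t ht),
    fun t x => ∑ i, deriv (c i) t • B i x, fun t _ =>
      G.sum_mem_scalarSpace (fun i => deriv (c i) t) hB fun x _ => rfl, fun t ht x hx => ?_,
    fun t ht x hx => ?_, fun J hJ hJc => ⟨?_, ?_, ?_, ?_⟩⟩
  · refine HasDerivAt.congr_of_eventuallyEq (f := fun s => ∑ i, c i s • B i x) ?_ ?_
    · exact HasDerivAt.fun_sum fun i _ => (hcder i t ht).smul_const _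
    · filter_upwards [Ioo_mem_nhds ht.1 ht.2] with s hs using hφ s hs x hx
  · rw [hgrad _ x hx]
    refine HasDerivAt.congr_of_eventuallyEq (f := fun s => ∑ i, c i s • gradient (B i) x) ?_ ?_
    · exact HasDerivAt.fun_sum fun i _ => (hcder i t ht).smul_const _
    · filter_upwards [Ioo_mem_nhds ht.1 ht.2] with s hs using hgradφ s hs x hx
  · refine BddContOn.congr ?_ fun z hz => hφ z.1 (hJ hz.1) z.2 (hsub hz.2)
    exact BddContOn.sum _ fun i _ => (bddContOn_time hJc ((hc i).continuousOn.mono hJ)).smul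
      (bddContOn_space (G.bddContOn_of_mem_scalarSpace (hB i)))
  · exact BddContOn.sum _ fun i _ => (bddContOn_time hJc ((hcd i).mono hJ)).smul
      (bddContOn_space (G.bddContOn_of_mem_scalarSpace (hB i)))
  · refine BddContOn.congr ?_ fun z hz => hgradφ z.1 (hJ hz.1) z.2 hz.2
    exact BddContOn.sum _ fun i _ => (bddContOn_time hJc ((hc i).continuousOn.mono hJ)).smul
      (bddContOn_space (bddContOn_gradient (G.fderiv_of_mem_scalarSpace (hB i)).2))
  · refine BddContOn.congr ?_ fun z hz => hgrad _ z.2 hz.2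
    exact BddContOn.sum _ fun i _ => (bddContOn_time hJc ((hcd i).mono hJ)).smul
      (bddContOn_space (bddContOn_gradient (G.fderiv_of_mem_scalarSpace (hB i)).2))

end GeometryMap

/-! ### Discretely divergence-free velocities -/

section DivergenceFree

variable {G : GeometryMap d} {M : KnotMesh d} {σ : SplineType M} {w : Sp d → Sp d}

theorem divergence_eq_zero_of_mem_elems (hw : w ∈ G.velocitySpace M σ)
    (hq : ∀ q ∈ G.pressureSpace M σ, ∫ x in G.domain, q x * divergence w x = 0) {x : Sp d}
    (hx : x ∈ G.elems M) : divergence w x = 0 := by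
  obtain ⟨P⟩ := exists_piolaData hw
  rw [P.divergence_eq hw hx]
  exact P.div_eq_zero hw hq (subset_closure (G.elems_subset_domain M hx))

/-- A skeleton point lies in some closed element. The trace of the derivative within that element is
continuous and zero in its interior, hence zero at the point, where it agrees with the full
derivative. -/
theorem divergence_eq_zero_of_differentiableAt (hw : w ∈ G.velocitySpace M σ)
    (hq : ∀ q ∈ G.pressureSpace M σ, ∫ x in G.domain, q x * divergence w x = 0) {x : Sp d}
    (hx : x ∈ G.domain) (hd : DifferentiableAt ℝ w x) : divergence w x = 0 := by
  obtain ⟨K, hK⟩ := mem_iUnion.1 (G.subset_closure_elems M (subset_closure hx))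
  have hu := G.uniqueDiffOn_closure_elem M K
  have hc : ContinuousOn
      (fun y => ∑ i, (fderivWithin ℝ w (closure (G.elem M K)) y (basisVec i)) i)
      (closure (G.elem M K)) := by
    refine continuousOn_finsetSum _ fun i _ => ?_
    exact (EuclideanSpace.proj i : Sp d →L[ℝ] ℝ).continuous.comp_continuousOn
      (((hw.2.2 K).continuousOn_fderivWithin hu le_rfl).clm_apply continuousOn_const)
  have hz : EqOn (fun y => ∑ i, (fderivWithin ℝ w (closure (G.elem M K)) y (basisVec i)) i) 0
      (G.elem M K) := fun y hy => by
    simp only [G.fderivWithin_closure_elem w hy]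
    exact divergence_eq_zero_of_mem_elems hw hq (G.elem_subset_elems M K hy)
  have := hz.of_subset_closure hc continuousOn_const subset_closure Subset.rfl hK
  unfold divergence
  simpa only [hd.fderivWithin (hu x hK), Pi.zero_apply] using this

theorem integral_fderiv_apply_eq_zero (hw : w ∈ G.velocitySpace M σ)
    (hq : ∀ q ∈ G.pressureSpace M σ, ∫ x in G.domain, q x * divergence w x = 0) {g : Sp d → ℝ}
    (hg : ContinuousOn (fun ξ => g (G.toFun ξ)) (closedCube d))
    (hd : ∀ x ∈ G.elems M, DifferentiableAt ℝ g x) (hb : BddContOn (fderiv ℝ g) (G.elems M)) :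
    ∫ x in G.domain, fderiv ℝ g x (w x) = 0 := by
  obtain ⟨P⟩ := exists_piolaData hw
  rw [P.integral_fderiv_apply hg hd hb, neg_eq_zero,
    setIntegral_congr_fun (g := fun _ => (0 : ℝ)) G.isOpen_domain.measurableSet]
  · simp
  · intro x hx
    simp [P.div_eq_zero hw hq (subset_closure hx)]

theorem integral_inner_gradient_eq_zero (hw : w ∈ G.velocitySpace M σ)
    (hq : ∀ q ∈ G.pressureSpace M σ, ∫ x in G.domain, q x * divergence w x = 0) {η : Sp d → ℝ}
    (hη : ContDiff ℝ 1 η) : ∫ x in G.domain, ⟪w x, gradient η x⟫_ℝ = 0 := by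
  simp only [gradient_inner]
  exact integral_fderiv_apply_eq_zero hw hq (hη.continuous.comp_continuousOn G.continuousOn_toFun)
    (fun x _ => hη.differentiable (by norm_num) x)
    (G.bddContOn_of_continuousOn_closure M (hη.continuous_fderiv (by norm_num)).continuousOn)

end DivergenceFree

/-! ### The regularized normal -/

theorem inv_regNorm_smul_norm_le (eps : ℝ) (b : Sp d) : ‖(regNorm eps b)⁻¹ • b‖ ≤ 1 := by
  rw [norm_smul, norm_inv, Real.norm_of_nonneg (regNorm_nonneg eps b), inv_mul_eq_div]
  exact div_le_one_of_le₀ (norm_le_regNorm eps b) (regNorm_nonneg eps b)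

/-- The bound 1 holds even if the regularized norm tends to 0 at the boundary of an element, so no
positive lower bound is required. -/
theorem bddContOn_inv_regNorm_smul {X : Type*} [TopologicalSpace X] {s : Set X} {eps : ℝ}
    {g : X → Sp d} (hg : ContinuousOn g s) (hne : ∀ x ∈ s, regNorm eps (g x) ≠ 0) :
    BddContOn (fun x => (regNorm eps (g x))⁻¹ • g x) s :=
  ⟨(((continuous_regNorm eps).comp_continuousOn hg).inv₀ hne).smul hg, 1,
    fun _ _ => inv_regNorm_smul_norm_le eps _⟩

theorem hasDerivAt_regNorm {eps : ℝ} {g : ℝ → Sp d} {g' : Sp d} {t : ℝ} (hg : HasDerivAt g g' t)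
    (hne : regNorm eps (g t) ≠ 0) :
    HasDerivAt (fun s => regNorm eps (g s)) ⟪(regNorm eps (g t))⁻¹ • g t, g'⟫_ℝ t := by
  have h0 : ⟪g t, g t⟫_ℝ + eps ^ 2 ≠ 0 := fun h => hne (by rw [regNorm, h, Real.sqrt_zero])
  have h1 := ((hg.inner ℝ hg).add_const (eps ^ 2)).sqrt h0
  refine h1.congr_deriv ?_
  change _ / (2 * regNorm eps (g t)) = _
  rw [real_inner_comm (g t) g', real_inner_smul_left]
  field_simp
  ring

theorem divergence_inv_regNorm_smul {eps : ℝ} {g : Sp d → Sp d} {x : Sp d}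
    (hg : DifferentiableAt ℝ g x) (hne : regNorm eps (g x) ≠ 0) :
    divergence (fun z => (regNorm eps (g z))⁻¹ • g z) x
      = (regNorm eps (g x))⁻¹ * divergence g x
        - (regNorm eps (g x))⁻¹ ^ 3 * ⟪g x, fderiv ℝ g x (g x)⟫_ℝ := by
  have h0 : ⟪g x, g x⟫_ℝ + eps ^ 2 ≠ 0 := fun h => hne (by rw [regNorm, h, Real.sqrt_zero])
  have hd : DifferentiableAt ℝ (fun z => regNorm eps (g z)) x :=
    ((hg.inner ℝ hg).add_const (eps ^ 2)).sqrt h0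
  have hd' := hd.fun_inv hne
  -- Restriction to the line through x in direction v reduces this to `hasDerivAt_regNorm` for
  -- curves.
  have hline : ∀ v, fderiv ℝ (fun z => (regNorm eps (g z))⁻¹) x v
      = -((regNorm eps (g x))⁻¹ ^ 3 * ⟪g x, fderiv ℝ g x v⟫_ℝ) := fun v => by
    have h1 : HasDerivAt (fun t : ℝ => g (x + t • v)) (fderiv ℝ g x v) 0 :=
      hg.hasFDerivAt.hasLineDerivAt v
    have h2 := (hasDerivAt_regNorm (eps := eps) h1 (by simpa using hne)).fun_inv
      (by simpa using hne)
    have h3 : HasDerivAt (fun t : ℝ => (regNorm eps (g (x + t • v)))⁻¹)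
        (fderiv ℝ (fun z => (regNorm eps (g z))⁻¹) x v) 0 := hd'.hasFDerivAt.hasLineDerivAt v
    rw [h3.unique h2]
    simp only [zero_smul, add_zero, real_inner_smul_left]
    field_simp
  rw [divergence_smul hd' hg, hline]
  ring

/-! ### Differentiation of the energy -/

section Energy

variable {par : FlowParams d} {M : KnotMesh d} {G : GeometryMap d} {σ : SplineType M}
  {N : NurbsType M} {T : ℝ} {τ : M.Elem → ℝ → Sp d → ℝ} {u : ℝ → Sp d → Sp d}
  {p φ v : ℝ → Sp d → ℝ}

namespace FlowParams

variable (par)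

/-- Time derivative of the energy density. -/
def energyDensityDeriv (u ut : Sp d → Sp d) (φ φt : Sp d → ℝ) (x : Sp d) : ℝ :=
  par.drho (φ x) * φt x * (1 / 2 * ‖u x‖ ^ 2) + par.rho (φ x) * ⟪u x, ut x⟫_ℝ
    + 1 / par.Fr ^ 2 * (par.drho (φ x) * φt x * par.height x)
    + 1 / par.We * (par.diracDeriv (φ x) * φt x * regNorm par.eps (gradient φ x)
      + par.dirac (φ x) * ⟪par.normal φ x, gradient φt x⟫_ℝ)

theorem hasDerivAt_energyDensity {ut : Sp d → Sp d} {φt : Sp d → ℝ} {t : ℝ} {x : Sp d}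
    (hu : HasDerivAt (fun s => u s x) (ut x) t) (hφ : HasDerivAt (fun s => φ s x) (φt x) t)
    (hg : HasDerivAt (fun s => gradient (φ s) x) (gradient φt x) t)
    (hne : regNorm par.eps (gradient (φ t) x) ≠ 0) :
    HasDerivAt (fun s => par.energyDensity (u s) (φ s) x)
      (par.energyDensityDeriv (u t) ut (φ t) φt x) t := by
  have h1 : HasDerivAt (fun s => par.rho (φ s x)) (par.drho (φ t x) * φt x) t :=
    (par.hasDerivAt_rho _).comp t hφ
  have h2 : HasDerivAt (fun s => par.dirac (φ s x)) (par.diracDeriv (φ t x) * φt x) t :=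
    (par.hasDerivAt_dirac _).comp t hφ
  have h3 := hasDerivAt_regNorm hg hne
  have h4 := hu.norm_sq
  have := (((h1.const_mul (1 / 2)).mul h4).add
    ((h1.mul_const (par.height x)).const_mul (1 / par.Fr ^ 2))).add
    ((h2.mul h3).const_mul (1 / par.We))
  refine this.congr_deriv ?_
  simp only [energyDensityDeriv, normal]
  ring

end FlowParams

theorem bddContOn_height (G : GeometryMap d) (M : KnotMesh d) (par : FlowParams d) :
    BddContOn par.height (G.elems M) :=
  G.bddContOn_of_continuousOn_closure M par.contDiff_height.continuous.continuousOn

theorem IsSmoothSolution.regNorm_ne_zero_elems (h : IsSmoothSolution par M G σ N T τ u p φ v)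
    {t : ℝ} (ht : t ∈ Ioo 0 T) {x : Sp d} (hx : x ∈ G.elems M) :
    regNorm par.eps (gradient (φ t) x) ≠ 0 := by
  obtain ⟨K, hK⟩ := mem_iUnion.1 hx
  exact h.regNorm_ne_zero t ht K x hK

/-- Time derivatives of the velocity and of the level-set function, with uniform bounds. -/
structure TimeDerivs (G : GeometryMap d) {M : KnotMesh d} (N : NurbsType M) (T : ℝ)
    (u : ℝ → Sp d → Sp d) (φ : ℝ → Sp d → ℝ) where
  ut : ℝ → Sp d → Sp d
  φt : ℝ → Sp d → ℝ
  φt_mem : ∀ t ∈ Ioo 0 T, φt t ∈ G.scalarSpace M N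
  hasDerivAt_u : ∀ t ∈ Ioo 0 T, ∀ x ∈ closure G.domain, HasDerivAt (fun s => u s x) (ut t x) t
  hasDerivAt_φ : ∀ t ∈ Ioo 0 T, ∀ x ∈ closure G.domain, HasDerivAt (fun s => φ s x) (φt t x) t
  hasDerivAt_grad : ∀ t ∈ Ioo 0 T, ∀ x ∈ G.elems M,
    HasDerivAt (fun s => gradient (φ s) x) (gradient (φt t) x) t
  bdd : ∀ J ⊆ Ioo 0 T, IsCompact J →
    BddContOn (fun z : ℝ × Sp d => u z.1 z.2) (J ×ˢ G.elems M) ∧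
    BddContOn (fun z : ℝ × Sp d => ut z.1 z.2) (J ×ˢ G.elems M) ∧
    BddContOn (fun z : ℝ × Sp d => φ z.1 z.2) (J ×ˢ G.elems M) ∧
    BddContOn (fun z : ℝ × Sp d => φt z.1 z.2) (J ×ˢ G.elems M) ∧
    BddContOn (fun z : ℝ × Sp d => gradient (φ z.1) z.2) (J ×ˢ G.elems M) ∧
    BddContOn (fun z : ℝ × Sp d => gradient (φt z.1) z.2) (J ×ˢ G.elems M)

theorem IsSmoothSolution.exists_timeDerivs (h : IsSmoothSolution par M G σ N T τ u p φ v) :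
    Nonempty (TimeDerivs G N T u φ) := by
  obtain ⟨-, ut, hu1, hu2⟩ := G.exists_timeDeriv_velocity h.u_mem
  obtain ⟨-, φt, hφ0, hφ1, hφ2, hφ3⟩ := G.exists_timeDeriv_scalar h.φ_mem
  exact ⟨⟨ut, φt, hφ0, hu1, hφ1, hφ2, fun J hJ hJc =>
    ⟨(hu2 J hJ hJc).1, (hu2 J hJ hJc).2, hφ3 J hJ hJc⟩⟩⟩

theorem TimeDerivs.bddContOn (D : TimeDerivs G N T u φ) {t : ℝ} (ht : t ∈ Ioo 0 T) :
    BddContOn (u t) (G.elems M) ∧ BddContOn (D.ut t) (G.elems M) ∧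
    BddContOn (φ t) (G.elems M) ∧ BddContOn (D.φt t) (G.elems M) ∧
    BddContOn (gradient (φ t)) (G.elems M) ∧ BddContOn (gradient (D.φt t)) (G.elems M) := by
  obtain ⟨h1, h2, h3, h4, h5, h6⟩ := D.bdd {t} (singleton_subset_iff.2 ht) isCompact_singleton
  have hm := mem_singleton t
  exact ⟨GeometryMap.bddContOn_slice h1 hm, GeometryMap.bddContOn_slice h2 hm,
    GeometryMap.bddContOn_slice h3 hm, GeometryMap.bddContOn_slice h4 hm,
    GeometryMap.bddContOn_slice h5 hm, GeometryMap.bddContOn_slice h6 hm⟩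

theorem TimeDerivs.bddContOn_energyDensity (h : IsSmoothSolution par M G σ N T τ u p φ v)
    (D : TimeDerivs G N T u φ) {J : Set ℝ} (hJ : J ⊆ Ioo 0 T) (hJc : IsCompact J) :
    BddContOn (fun z : ℝ × Sp d => par.energyDensity (u z.1) (φ z.1) z.2) (J ×ˢ G.elems M) ∧
    BddContOn (fun z : ℝ × Sp d =>
      par.energyDensityDeriv (u z.1) (D.ut z.1) (φ z.1) (D.φt z.1) z.2) (J ×ˢ G.elems M) := by
  obtain ⟨bu, but, bφ, bφt, bg, bgt⟩ := D.bdd J hJ hJc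
  have by_ : BddContOn (fun z : ℝ × Sp d => par.height z.2) (J ×ˢ G.elems M) :=
    GeometryMap.bddContOn_space (bddContOn_height G M par)
  have bρ := bφ.comp par.contDiff_rho.continuous
  have bρ' := bφ.comp par.continuous_drho
  have bδ := bφ.comp par.contDiff_dirac.continuous
  have bδ' := bφ.comp par.continuous_diracDeriv
  have br := bg.comp (continuous_regNorm par.eps)
  have bn := bddContOn_inv_regNorm_smul (eps := par.eps) bg.1
    fun z hz => h.regNorm_ne_zero_elems (hJ hz.1) hz.2
  have bu2 : BddContOn (fun z : ℝ × Sp d => ‖u z.1 z.2‖ ^ 2) (J ×ˢ G.elems M) :=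
    bu.comp (g := fun a : Sp d => ‖a‖ ^ 2) (by fun_prop)
  constructor
  · exact ((((bddContOn_const (1 / 2 : ℝ)).mul bρ).mul bu2).add
      ((bddContOn_const _).mul (bρ.mul by_))).add ((bddContOn_const _).mul (bδ.mul br))
  · exact ((((bρ'.mul bφt).mul ((bddContOn_const (1 / 2 : ℝ)).mul bu2)).add
      (bρ.mul (bddContOn_inner bu but))).add
      ((bddContOn_const _).mul ((bρ'.mul bφt).mul by_))).add
      ((bddContOn_const _).mul (((bδ'.mul bφt).mul br).add (bδ.mul (bddContOn_inner bn bgt))))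

/-- Differentiation under the integral with a constant dominating function, which is integrable
since Ω has finite volume. -/
theorem TimeDerivs.hasDerivAt_energy (h : IsSmoothSolution par M G σ N T τ u p φ v)
    (D : TimeDerivs G N T u φ) {t : ℝ} (ht : t ∈ Ioo 0 T) :
    IntegrableOn (par.energyDensity (u t) (φ t)) G.domain ∧
    HasDerivAt (fun s => energy par G (u s) (φ s))
      (∫ x in G.domain, par.energyDensityDeriv (u t) (D.ut t) (φ t) (D.φt t) x) t := by
  -- A compact time interval inside (0,T) provides one bound for all nearby times.
  obtain ⟨r, hr, hball⟩ := Metric.nhds_basis_closedBall.mem_iff.1 (Ioo_mem_nhds ht.1 ht.2)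
  have hnhds : Metric.closedBall t r ∈ 𝓝 t := Metric.closedBall_mem_nhds t hr
  obtain ⟨b1, b2⟩ := D.bddContOn_energyDensity h hball (isCompact_closedBall t r)
  have hI : ∀ s ∈ Metric.closedBall t r,
      IntegrableOn (par.energyDensity (u s) (φ s)) G.domain := fun s hs =>
    G.integrableOn_domain M (GeometryMap.bddContOn_slice b1 hs)
  have htb := Metric.mem_closedBall_self (x := t) hr.le
  refine ⟨hI t htb, ?_⟩
  obtain ⟨C, hC⟩ := b2.2
  have hconst : Integrable (fun _ : Sp d => C) (volume.restrict G.domain) :=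
    integrableOn_const G.volume_domain_lt_top.ne
  refine (hasDerivAt_integral_of_dominated_loc_of_deriv_le (bound := fun _ => C)
    (μ := volume.restrict G.domain) (F := fun s x => par.energyDensity (u s) (φ s) x) hnhds ?_
    (hI t htb)
    (F' := fun s x => par.energyDensityDeriv (u s) (D.ut s) (φ s) (D.φt s) x)
    (G.integrableOn_domain M (GeometryMap.bddContOn_slice b2 htb)).aestronglyMeasurable
    ?_ hconst ?_).2
  · filter_upwards [hnhds] with s hs using (hI s hs).aestronglyMeasurable
  · filter_upwards [G.ae_mem_elems M] with x hx s hs using hC (s, x) ⟨hs, hx⟩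
  · filter_upwards [G.ae_mem_elems M] with x hx s hs
    have hxc := subset_closure (G.elems_subset_domain M hx)
    have hsI := hball hs
    exact par.hasDerivAt_energyDensity (D.hasDerivAt_u s hsI x hxc) (D.hasDerivAt_φ s hsI x hxc)
      (D.hasDerivAt_grad s hsI x hx) (h.regNorm_ne_zero_elems hsI hx)

theorem TimeDerivs.deriv_rho_smul (D : TimeDerivs G N T u φ) (par : FlowParams d) {t : ℝ}
    (ht : t ∈ Ioo 0 T) {x : Sp d} (hx : x ∈ closure G.domain) :
    deriv (fun s => par.rho (φ s x) • u s x) t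
      = par.rho (φ t x) • D.ut t x + (par.drho (φ t x) * D.φt t x) • u t x :=
  HasDerivAt.deriv (((par.hasDerivAt_rho _).comp t (D.hasDerivAt_φ t ht x hx)).smul
    (D.hasDerivAt_u t ht x hx) :)

end Energy

/-! ### Boundedness of the momentum residual -/

theorem continuous_frob : Continuous fun q : (Sp d →L[ℝ] Sp d) × (Sp d →L[ℝ] Sp d) =>
    frob q.1 q.2 := by
  unfold frob
  fun_prop

theorem bddContOn_frob {X : Type*} [TopologicalSpace X] {s : Set X} {A B : X → Sp d →L[ℝ] Sp d}
    (hA : BddContOn A s) (hB : BddContOn B s) : BddContOn (fun x => frob (A x) (B x)) s :=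
  hA.comp₂ (k := frob) continuous_frob hB

theorem bddContOn_apply {X : Type*} [TopologicalSpace X] {s : Set X} {A : X → Sp d →L[ℝ] Sp d}
    {w : X → Sp d} (hA : BddContOn A s) (hw : BddContOn w s) : BddContOn (fun x => A x (w x)) s :=
  hA.comp₂ (k := fun A v => A v) (by fun_prop) hw

theorem bddContOn_coord {X : Type*} [TopologicalSpace X] {s : Set X} {w : X → Sp d}
    (hw : BddContOn w s) (i : Fin d) : BddContOn (fun x => w x i) s :=
  hw.comp (g := fun v : Sp d => v i) (by fun_prop)

theorem bddContOn_divergence {s : Set (Sp d)} {w : Sp d → Sp d} (hw : BddContOn (fderiv ℝ w) s) :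
    BddContOn (divergence w) s :=
  BddContOn.sum _ fun i _ => bddContOn_coord (bddContOn_apply hw (bddContOn_const (basisVec i))) i

namespace GeometryMap

variable (G : GeometryMap d) {M : KnotMesh d} {K : M.Elem} {Y : Type*} [NormedAddCommGroup Y]
  [NormedSpace ℝ Y]

theorem bddContOn_fderiv_of_eqOn {f g : Sp d → Y} (hg : ContDiffOn ℝ 1 g (closure (G.elem M K)))
    (hfg : EqOn f g (G.elem M K)) : BddContOn (fderiv ℝ f) (G.elem M K) := by
  refine (G.bddContOn_fderiv hg).congr fun x hx => Filter.EventuallyEq.fderiv_eq ?_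
  filter_upwards [(G.isOpen_elem M K).mem_nhds hx] with y hy using hfg hy

theorem contDiffOn_fderivWithin_closure_elem {f : Sp d → Y}
    (hf : ContDiffOn ℝ 2 f (closure (G.elem M K))) :
    ContDiffOn ℝ 1 (fderivWithin ℝ f (closure (G.elem M K))) (closure (G.elem M K)) :=
  hf.fderivWithin (G.uniqueDiffOn_closure_elem M K) (by norm_num)

theorem bddContOn_fderiv_gradient {φ : Sp d → ℝ}
    (hφ : ContDiffOn ℝ 2 φ (closure (G.elem M K))) :
    BddContOn (fderiv ℝ (gradient φ)) (G.elem M K) := by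
  refine G.bddContOn_fderiv_of_eqOn (g := fun x => (InnerProductSpace.toDual ℝ (Sp d)).symm
    (fderivWithin ℝ φ (closure (G.elem M K)) x)) ?_ fun x hx => ?_
  · exact (InnerProductSpace.toDual ℝ (Sp d)).symm.toContinuousLinearEquiv.contDiff.comp_contDiffOn
      (G.contDiffOn_fderivWithin_closure_elem hφ)
  · simp only [G.fderivWithin_closure_elem φ hx, gradient]

theorem differentiableAt_gradient {φ : Sp d → ℝ}
    (hφ : ContDiffOn ℝ 2 φ (closure (G.elem M K))) {x : Sp d} (hx : x ∈ G.elem M K) :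
    DifferentiableAt ℝ (gradient φ) x := by
  have h1 : ContDiffAt ℝ 1 (fderiv ℝ φ) x :=
    (G.contDiffAt_of_closure_elem hφ hx).fderiv_right (by norm_num)
  exact DifferentiableAt.comp x
    ((InnerProductSpace.toDual ℝ (Sp d)).symm.toContinuousLinearEquiv.differentiableAt)
    (h1.differentiableAt (by norm_num))

theorem bddContOn_matDivergence_stress (par : FlowParams d) {u : Sp d → Sp d} {φ : Sp d → ℝ}
    (hu : ContDiffOn ℝ 2 u (closure (G.elem M K))) (hφ : ContDiffOn ℝ 2 φ (closure (G.elem M K))) :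
    BddContOn (matDivergence (par.stress u φ)) (G.elem M K) := by
  refine BddContOn.sum _ fun j _ => bddContOn_apply ?_ (bddContOn_const (basisVec j))
  let A := fderivWithin ℝ u (closure (G.elem M K))
  have hA : ContDiffOn ℝ 1 A (closure (G.elem M K)) := G.contDiffOn_fderivWithin_closure_elem hu
  -- The adjoint is written in coordinates, Aᵀe_j = ∑_i (A e_i)_j e_i, so that its C¹ dependence on
  -- x is visible.
  refine G.bddContOn_fderiv_of_eqOn (g := fun x => (par.Rey⁻¹ * par.mu (φ x)) •
    (A x (basisVec j) + ∑ i, (A x (basisVec i) j) • (basisVec i : Sp d))) ?_ fun x hx => ?_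
  · have hφ1 : ContDiffOn ℝ 1 φ (closure (G.elem M K)) := hφ.of_le (by norm_num)
    have hmu : ContDiffOn ℝ 1 (fun x => par.mu (φ x)) (closure (G.elem M K)) :=
      (par.contDiff_mu.of_le (by norm_num)).comp_contDiffOn hφ1
    have hAe : ∀ i, ContDiffOn ℝ 1 (fun x => A x (basisVec i)) (closure (G.elem M K)) :=
      fun i => hA.clm_apply contDiffOn_const
    refine (contDiffOn_const.mul hmu).smul ((hAe j).add (ContDiffOn.sum fun i _ => ?_))
    exact ((EuclideanSpace.proj j : Sp d →L[ℝ] ℝ).contDiff.comp_contDiffOn (hAe i)).smul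
      contDiffOn_const
  · simp only [A, G.fderivWithin_closure_elem u hx, FlowParams.stress]
    rw [smul_apply, add_apply]
    congr 2
    rw [← sum_smul_basisVec (ContinuousLinearMap.adjoint (fderiv ℝ u x) (basisVec j))]
    simp only [adjoint_basisVec]

/-- The curvature alone may blow up near an element boundary when the regularized norm tends to 0.
Multiplied by ∇φ it becomes (Δφ)ν − ⟨ν, D²φ ν⟩ν, in which only the bounded ν and second derivatives
occur. -/
theorem bddContOn_curvature_smul_gradient (par : FlowParams d) {φ : Sp d → ℝ}
    (hφ : ContDiffOn ℝ 2 φ (closure (G.elem M K)))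
    (hne : ∀ x ∈ G.elem M K, regNorm par.eps (gradient φ x) ≠ 0) :
    BddContOn (fun x => par.curvature φ x • gradient φ x) (G.elem M K) := by
  have hfd := G.bddContOn_fderiv_gradient hφ
  have hc : ContinuousOn (gradient φ) (G.elem M K) := fun x hx =>
    (G.differentiableAt_gradient hφ hx).continuousAt.continuousWithinAt
  have hn := bddContOn_inv_regNorm_smul hc hne
  refine (((bddContOn_divergence hfd).smul hn).sub
    ((bddContOn_inner hn (bddContOn_apply hfd hn)).smul hn)).congr fun x hx => ?_
  dsimp only [FlowParams.curvature, FlowParams.normal]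
  rw [show par.normal φ = fun z => (regNorm par.eps (gradient φ z))⁻¹ • gradient φ z from rfl,
    divergence_inv_regNorm_smul (G.differentiableAt_gradient hφ hx) (hne x hx), map_smul,
    real_inner_smul_left, real_inner_smul_right, smul_smul, smul_smul, ← sub_smul]
  congr 1
  ring

theorem bddContOn_meshSize : BddContOn (G.meshSize M K) (G.elem M K) := by
  have h1 : ContinuousOn (fun x => G.jac (G.inv x)) (closure G.domain) :=
    G.continuousOn_jac.comp G.continuousOn_inv fun x hx => G.inv_mem hx
  have h2 : BddContOn (fun x => G.jac (G.inv x)) (G.elem M K) :=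
    h1.bddContOn G.isCompact_closure_domain ((G.elem_subset_domain M K).trans subset_closure)
  have h3 : Continuous fun A : Sp d →L[ℝ] Sp d => Real.sqrt (M.diam K ^ 2 / d * frob A A) :=
    ((continuous_const.mul (continuous_frob.comp (continuous_id.prodMk continuous_id)))).sqrt
  exact BddContOn.comp (g := fun A => Real.sqrt (M.diam K ^ 2 / d * frob A A)) h3 h2

/-- For `eps = 0` the denominator may vanish, so the quotient is treated as measurable and bounded:
A : A over its regularized norm is at most that norm. -/
theorem integrableOn_frob_dcViscosity {A : Sp d → Sp d →L[ℝ] Sp d} {m : Sp d → ℝ} (eps : ℝ)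
    (hA : BddContOn A (G.elem M K)) (hm : BddContOn m (G.elem M K)) :
    IntegrableOn (fun x => m x * (frob (A x) (A x) / regNormMat eps (A x))) (G.elem M K) := by
  have hmeas := (G.isOpen_elem M K).measurableSet
  have hf : BddContOn (fun x => frob (A x) (A x)) (G.elem M K) :=
    bddContOn_frob hA hA
  have hr : BddContOn (fun x => regNormMat eps (A x)) (G.elem M K) :=
    hf.comp (g := fun a : ℝ => Real.sqrt (a + eps ^ 2)) (by fun_prop)
  obtain ⟨C, hC⟩ := hm.2
  obtain ⟨D, hD⟩ := hr.2
  have hfin : volume (G.elem M K) < ⊤ :=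
    (measure_mono (G.elem_subset_domain M K)).trans_lt G.volume_domain_lt_top
  have : IsFiniteMeasure (volume.restrict (G.elem M K)) := isFiniteMeasure_restrict.2 hfin.ne
  refine Integrable.of_bound (C := C * D) ?_ ?_
  · exact (hm.1.aestronglyMeasurable hmeas).mul
      ((hf.1.aemeasurable hmeas).div (hr.1.aemeasurable hmeas)).aestronglyMeasurable
  · filter_upwards [ae_restrict_mem hmeas] with x hx
    have h0 := regNormMat_nonneg eps (A x)
    rw [norm_mul]
    refine mul_le_mul (hC x hx) ?_ (norm_nonneg _) ((norm_nonneg _).trans (hC x hx))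
    refine le_trans ?_ (hD x hx)
    rw [Real.norm_of_nonneg (div_nonneg (frob_self_nonneg _) h0), Real.norm_of_nonneg h0]
    -- This form of the estimate includes a zero denominator, where the quotient is 0 by convention.
    exact div_le_of_le_mul₀ h0 h0 (by rw [← sq]; exact frob_self_le_regNormMat_sq eps (A x))

end GeometryMap

/-! ### Admissible test functions, and integrability and sign of the dissipation. -/

section Energy

variable {par : FlowParams d} {M : KnotMesh d} {G : GeometryMap d} {σ : SplineType M}
  {N : NurbsType M} {T : ℝ} {τ : M.Elem → ℝ → Sp d → ℝ} {u : ℝ → Sp d → Sp d}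
  {p φ v : ℝ → Sp d → ℝ}

theorem IsSmoothSolution.u_mem_velocitySpace (h : IsSmoothSolution par M G σ N T τ u p φ v)
    {t : ℝ} (ht : t ∈ Ioo 0 T) : u t ∈ G.velocitySpace M σ :=
  (G.exists_timeDeriv_velocity h.u_mem).1 t ht

theorem IsSmoothSolution.φ_mem_scalarSpace (h : IsSmoothSolution par M G σ N T τ u p φ v)
    {t : ℝ} (ht : t ∈ Ioo 0 T) : φ t ∈ G.scalarSpace M N :=
  (G.exists_timeDeriv_scalar h.φ_mem).1 t ht

theorem IsSmoothSolution.v_mem_scalarSpace (h : IsSmoothSolution par M G σ N T τ u p φ v)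
    {t : ℝ} (ht : t ∈ Ioo 0 T) : v t ∈ G.scalarSpace M N :=
  (G.exists_timeDeriv_scalar h.v_mem).1 t ht

theorem IsSmoothSolution.bddContOn_fderiv_u (h : IsSmoothSolution par M G σ N T τ u p φ v)
    {t : ℝ} (ht : t ∈ Ioo 0 T) : BddContOn (fderiv ℝ (u t)) (G.elems M) :=
  G.bddContOn_elems M fun K => G.bddContOn_fderiv ((h.u_smooth t ht K).of_le (by norm_num))

theorem IsSmoothSolution.bddContOn_momentumResidual
    (h : IsSmoothSolution par M G σ N T τ u p φ v) {t : ℝ} (ht : t ∈ Ioo 0 T) (K : M.Elem) :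
    BddContOn (par.momentumResidual u p φ t) (G.elem M K) := by
  obtain ⟨D⟩ := h.exists_timeDerivs
  have hsub := G.elem_subset_elems M K
  obtain ⟨bu, but, bφ, bφt, bg, -⟩ := D.bddContOn ht
  have bρ := (bφ.mono hsub).comp par.contDiff_rho.continuous
  have hu1 : ContDiffOn ℝ 1 (u t) (closure (G.elem M K)) :=
    (h.u_smooth t ht K).of_le (by norm_num)
  have hφ1 : ContDiffOn ℝ 1 (φ t) (closure (G.elem M K)) :=
    (h.φ_smooth t ht K).of_le (by norm_num)
  have hρ1 : ContDiffOn ℝ 1 (fun x => par.rho (φ t x)) (closure (G.elem M K)) :=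
    (par.contDiff_rho.of_le (by norm_num)).comp_contDiffOn hφ1
  have b1 : BddContOn (fun x => deriv (fun s => par.rho (φ s x) • u s x) t) (G.elem M K) := by
    refine ((bρ.smul (but.mono hsub)).add ((((bφ.comp par.continuous_drho).mul bφt).smul
      bu).mono hsub)).congr fun x hx => ?_
    exact D.deriv_rho_smul par ht (subset_closure (G.elem_subset_domain M K hx))
  have b2 : BddContOn (fun x => ∑ j, fderiv ℝ (fun z => (par.rho (φ t z) * u t z j) • u t z) x
      (basisVec j)) (G.elem M K) := by
    refine BddContOn.sum _ fun j _ => bddContOn_apply (G.bddContOn_fderiv ?_)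
      (bddContOn_const (basisVec j))
    exact (hρ1.mul ((EuclideanSpace.proj j : Sp d →L[ℝ] ℝ).contDiff.comp_contDiffOn hu1)).smul hu1
  have b3 := G.bddContOn_matDivergence_stress par (h.u_smooth t ht K) (h.φ_smooth t ht K)
  have b4 := bddContOn_gradient (G.bddContOn_fderiv (h.p_smooth t ht K))
  have b5 : BddContOn (fun x => (1 / par.We * (par.dirac (φ t x) * par.curvature (φ t) x)) •
      gradient (φ t) x) (G.elem M K) := by
    have := G.bddContOn_curvature_smul_gradient par (h.φ_smooth t ht K)
      (h.regNorm_ne_zero t ht K)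
    refine (((bddContOn_const (1 / par.We)).mul
      ((bφ.mono hsub).comp par.contDiff_dirac.continuous)).smul this).congr fun x _ => ?_
    dsimp only
    rw [smul_smul, mul_assoc]
  have b6 : BddContOn (fun x => (1 / par.Fr ^ 2 * par.rho (φ t x)) • par.vert) (G.elem M K) :=
    ((bddContOn_const _).mul bρ).smul (bddContOn_const _)
  exact ((((b1.add b2).sub b3).add b4).add b5).add b6

theorem dcViscosity_nonneg (K : M.Elem) (t : ℝ) (x : Sp d) :
    0 ≤ dcViscosity par M G u p φ K t x :=
  mul_nonneg (mul_nonneg par.Cdc_nonneg (Real.sqrt_nonneg _))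
    (div_nonneg (regNorm_nonneg _ _) (regNormMat_nonneg _ _))

theorem dcTerm_self_nonneg (t : ℝ) : 0 ≤ dcTerm par M G u p φ t (u t) := by
  refine Finset.sum_nonneg fun K _ => integral_nonneg fun x => ?_
  rw [Pi.zero_apply, frob_smul_right]
  exact mul_nonneg (dcViscosity_nonneg K t x) (frob_self_nonneg _)

theorem viscousTerm_self_nonneg (w : Sp d → Sp d) (ψ : Sp d → ℝ) :
    0 ≤ viscousTerm par G w ψ w := by
  refine integral_nonneg fun x => ?_
  rw [Pi.zero_apply, FlowParams.stress, frob_smul_right]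
  exact mul_nonneg (mul_nonneg (inv_nonneg.2 par.Rey_pos.le) (par.mu_nonneg _))
    (frob_add_adjoint_nonneg _)

theorem IsSmoothSolution.integrableOn_dc (h : IsSmoothSolution par M G σ N T τ u p φ v)
    {t : ℝ} (ht : t ∈ Ioo 0 T) (K : M.Elem) :
    IntegrableOn (fun x => frob (fderiv ℝ (u t) x)
      (dcViscosity par M G u p φ K t x • fderiv ℝ (u t) x)) (G.elem M K) := by
  have bA := (h.bddContOn_fderiv_u ht).mono (G.elem_subset_elems M K)
  have bR := (h.bddContOn_momentumResidual ht K).comp (continuous_regNorm par.eps)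
  refine (G.integrableOn_frob_dcViscosity par.eps bA
    (((bddContOn_const par.Cdc).mul G.bddContOn_meshSize).mul bR)).congr (ae_of_all _ fun x => ?_)
  simp only [frob_smul_right, dcViscosity]
  ring

theorem IsSmoothSolution.integrableOn_viscous (h : IsSmoothSolution par M G σ N T τ u p φ v)
    {t : ℝ} (ht : t ∈ Ioo 0 T) :
    IntegrableOn (fun x => frob (fderiv ℝ (u t) x) (par.stress (u t) (φ t) x)) G.domain := by
  refine G.integrableOn_domain M ?_
  have bA := h.bddContOn_fderiv_u ht
  have bφ := G.bddContOn_of_mem_scalarSpace (h.φ_mem_scalarSpace ht)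
  have b1 : BddContOn (par.stress (u t) (φ t)) (G.elems M) :=
    ((bddContOn_const _).mul (bφ.comp par.contDiff_mu.continuous)).smul
      (bA.add (bA.comp (g := fun A => ContinuousLinearMap.adjoint A)
        (ContinuousLinearMap.adjoint (𝕜 := ℝ) (E := Sp d) (F := Sp d)).continuous))
  exact bddContOn_frob bA b1

end Energy

/-! ### The energy identity -/

section Energy

variable {par : FlowParams d} {M : KnotMesh d} {G : GeometryMap d} {σ : SplineType M}
  {N : NurbsType M} {T : ℝ} {τ : M.Elem → ℝ → Sp d → ℝ} {u : ℝ → Sp d → Sp d}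
  {p φ v : ℝ → Sp d → ℝ}

/-- With these weights both terms are the same integral with opposite signs, whatever the
stabilization parameter; no integrability is needed. -/
theorem supgLevelSet_add_supgMomentum (t : ℝ) :
    supgLevelSet M G τ u φ t (v t) + supgMomentum M G τ u φ v t (u t) = 0 :=
  add_neg_cancel _

namespace FlowParams

variable (par)

/-- Kinetic minus potential energy density. -/
def lagrangian (w : Sp d → Sp d) (ψ : Sp d → ℝ) (x : Sp d) : ℝ :=
  par.rho (ψ x) * (1 / 2 * ‖w x‖ ^ 2 - 1 / par.Fr ^ 2 * par.height x)

/-- For e = w this is precisely the sum of the convective, gravity and ϱ-weighted momentum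
integrands, up to sign. -/
theorem fderiv_lagrangian {w : Sp d → Sp d} {ψ : Sp d → ℝ} {x : Sp d}
    (hw : DifferentiableAt ℝ w x) (hψ : DifferentiableAt ℝ ψ x) (e : Sp d) :
    DifferentiableAt ℝ (par.lagrangian w ψ) x ∧ fderiv ℝ (par.lagrangian w ψ) x e
      = par.drho (ψ x) * ⟪e, gradient ψ x⟫_ℝ
          * (1 / 2 * ‖w x‖ ^ 2 - 1 / par.Fr ^ 2 * par.height x)
        + par.rho (ψ x) * (⟪w x, fderiv ℝ w x e⟫_ℝ - 1 / par.Fr ^ 2 * ⟪e, par.vert⟫_ℝ) := by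
  have h1 := (par.hasDerivAt_rho (ψ x)).comp_hasFDerivAt x hψ.hasFDerivAt
  have h2 := (hw.hasFDerivAt.norm_sq.const_mul (1 / 2)).sub
    ((par.hasFDerivAt_height x).const_mul (1 / par.Fr ^ 2))
  have h3 := h1.mul h2
  refine ⟨h3.differentiableAt, ?_⟩
  have h4 : fderiv ℝ (par.lagrangian w ψ) x = _ := h3.fderiv
  rw [h4, gradient_inner]
  simp [real_inner_comm par.vert e]
  ring

end FlowParams

theorem IsSmoothSolution.integral_fderiv_lagrangian
    (h : IsSmoothSolution par M G σ N T τ u p φ v) {t : ℝ} (ht : t ∈ Ioo 0 T) :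
    IntegrableOn (fun x => fderiv ℝ (par.lagrangian (u t) (φ t)) x (u t x)) G.domain ∧
    ∫ x in G.domain, fderiv ℝ (par.lagrangian (u t) (φ t)) x (u t x) = 0 := by
  have hu := h.u_mem_velocitySpace ht
  have hsm : ∀ K, ContDiffOn ℝ 1 (par.lagrangian (u t) (φ t)) (closure (G.elem M K)) := fun K => by
    have hρ := (par.contDiff_rho.of_le (show (1 : WithTop ℕ∞) ≤ 2 by norm_num)).comp_contDiffOn
      ((h.φ_smooth t ht K).of_le (by norm_num))
    exact hρ.mul ((contDiffOn_const.mul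
      (((h.u_smooth t ht K).of_le (by norm_num)).norm_sq ℝ)).sub
      (contDiffOn_const.mul (par.contDiff_height.of_le le_top).contDiffOn))
  have hb : BddContOn (fderiv ℝ (par.lagrangian (u t) (φ t))) (G.elems M) :=
    G.bddContOn_elems M fun K => G.bddContOn_fderiv (hsm K)
  refine ⟨G.integrableOn_domain M (hb.comp₂ (k := fun A v => A v) (by fun_prop)
    (G.bddContOn_of_mem_velocitySpace hu)), ?_⟩
  refine integral_fderiv_apply_eq_zero hu (h.continuity t ht) ?_ (fun x hx => ?_) hb
  · obtain ⟨P⟩ := exists_piolaData hu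
    exact (par.contDiff_rho.continuous.comp_continuousOn
      (G.continuousOn_comp_of_mem_scalarSpace (h.φ_mem_scalarSpace ht))).mul
      ((continuousOn_const.mul (P.continuousOn_comp_toFun.norm.pow 2)).sub (continuousOn_const.mul
        (par.contDiff_height.continuous.comp_continuousOn G.continuousOn_toFun)))
  · obtain ⟨K, hK⟩ := mem_iUnion.1 hx
    exact (G.contDiffAt_of_closure_elem (hsm K) hK).differentiableAt (by norm_num)

/-- The sign pattern is that of momentum plus level-set minus additional equation, without the
pressure, viscous and elementwise terms; r stands for 1/Fr². -/
theorem integral_combination {X : Type*} [MeasurableSpace X] {μ : Measure X}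
    {a b c e f g k l m : X → ℝ} (ha : Integrable a μ) (hb : Integrable b μ) (hc : Integrable c μ)
    (he : Integrable e μ) (hf : Integrable f μ) (hg : Integrable g μ) (hk : Integrable k μ)
    (hl : Integrable l μ) (hm : Integrable m μ) (r : ℝ) :
    ∫ x, (a x - b x + r * c x - e x - f x + g x - (k x - l x - m x)) ∂μ
      = ∫ x, a x ∂μ - ∫ x, b x ∂μ + r * ∫ x, c x ∂μ - ∫ x, e x ∂μ - ∫ x, f x ∂μ + ∫ x, g x ∂μ
        - (∫ x, k x ∂μ - ∫ x, l x ∂μ - ∫ x, m x ∂μ) := by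
  have e1 : ∫ x, (a x - b x) ∂μ = ∫ x, a x ∂μ - ∫ x, b x ∂μ := integral_sub ha hb
  have i1 := ha.sub hb
  have e2 : ∫ x, (a x - b x + r * c x) ∂μ = ∫ x, (a x - b x) ∂μ + ∫ x, r * c x ∂μ :=
    integral_add i1 (hc.const_mul r)
  have i2 := i1.add (hc.const_mul r)
  have e3 : ∫ x, (a x - b x + r * c x - e x) ∂μ
      = ∫ x, (a x - b x + r * c x) ∂μ - ∫ x, e x ∂μ := integral_sub i2 he
  have i3 := i2.sub he
  have e4 : ∫ x, (a x - b x + r * c x - e x - f x) ∂μ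
      = ∫ x, (a x - b x + r * c x - e x) ∂μ - ∫ x, f x ∂μ := integral_sub i3 hf
  have i4 := i3.sub hf
  have e5 : ∫ x, (a x - b x + r * c x - e x - f x + g x) ∂μ
      = ∫ x, (a x - b x + r * c x - e x - f x) ∂μ + ∫ x, g x ∂μ := integral_add i4 hg
  have i5 := i4.add hg
  have e6 : ∫ x, (k x - l x) ∂μ = ∫ x, k x ∂μ - ∫ x, l x ∂μ := integral_sub hk hl
  have i6 := hk.sub hl
  have e7 : ∫ x, (k x - l x - m x) ∂μ = ∫ x, (k x - l x) ∂μ - ∫ x, m x ∂μ := integral_sub i6 hm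
  have i7 := i6.sub hm
  have e8 : ∫ x, (a x - b x + r * c x - e x - f x + g x - (k x - l x - m x)) ∂μ
      = ∫ x, (a x - b x + r * c x - e x - f x + g x) ∂μ - ∫ x, (k x - l x - m x) ∂μ :=
    integral_sub i5 i7
  rw [e8, e7, e6, e5, e4, e3, e2, e1, integral_const_mul]

/-- Pointwise on the elements, the combined integrands equal the energy rate minus u · ∇ of the
Lagrangian density. The latter integrates to zero, so the weak equations leave only the dissipation.
-/
theorem TimeDerivs.energy_balance (h : IsSmoothSolution par M G σ N T τ u p φ v)
    (D : TimeDerivs G N T u φ) {t : ℝ} (ht : t ∈ Ioo 0 T) :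
    ∫ x in G.domain, par.energyDensityDeriv (u t) (D.ut t) (φ t) (D.φt t) x
      = -viscousTerm par G (u t) (φ t) (u t) - dcTerm par M G u p φ t (u t) := by
  have hu := h.u_mem_velocitySpace ht
  -- The three test functions are u, v and ∂ₜφ. The last pairs the additional equation with the rate
  -- of change of the interface energy.
  have hmom := h.momentum t ht (u t) hu
  have hlev := h.levelSet t ht (v t) (h.v_mem_scalarSpace ht)
  have hadd := h.additional t ht (D.φt t) (D.φt_mem t ht)
  have hsupg := supgLevelSet_add_supgMomentum (G := G) (τ := τ) (u := u) (φ := φ) (v := v) t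
  have hpres : ∫ x in G.domain, divergence (u t) x * p t x = 0 := by
    rw [G.setIntegral_domain_congr M (g := fun _ => (0 : ℝ)) fun x hx => by
      rw [divergence_eq_zero_of_mem_elems hu (h.continuity t ht) hx, zero_mul]]
    simp
  have hsub : ∀ x ∈ G.elems M, x ∈ closure G.domain := fun x hx =>
    subset_closure (G.elems_subset_domain M hx)
  obtain ⟨bu, but, bφ, bφt, bg, bgt⟩ := D.bddContOn ht
  have bv := G.bddContOn_of_mem_scalarSpace (h.v_mem_scalarSpace ht)
  have by_ := bddContOn_height G M par
  have bA := h.bddContOn_fderiv_u ht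
  have bρ := bφ.comp par.contDiff_rho.continuous
  have bρ' := bφ.comp par.continuous_drho
  have bδ := bφ.comp par.contDiff_dirac.continuous
  have bδ' := bφ.comp par.continuous_diracDeriv
  have br := bg.comp (continuous_regNorm par.eps)
  have bn : BddContOn (par.normal (φ t)) (G.elems M) :=
    bddContOn_inv_regNorm_smul (eps := par.eps) bg.1 fun x hx => h.regNorm_ne_zero_elems ht hx
  have bB : BddContOn (fun x => par.drho (φ t x) *
      (‖u t x‖ ^ 2 / 2 - 1 / par.Fr ^ 2 * par.height x)) (G.elems M) :=
    bρ'.mul ((bu.comp (g := fun a : Sp d => ‖a‖ ^ 2 / 2) (by fun_prop)).sub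
      ((bddContOn_const _).mul by_))
  have bdt : BddContOn (fun x => deriv (fun s => par.rho (φ s x) • u s x) t) (G.elems M) :=
    ((bρ.smul but).add ((bρ'.mul bφt).smul bu)).congr fun x hx => D.deriv_rho_smul par ht (hsub x hx)
  have hres : ∀ x ∈ G.elems M,
      levelSetResidual u φ t x = D.φt t x + ⟪u t x, gradient (φ t) x⟫_ℝ := fun x hx => by
    rw [levelSetResidual, (D.hasDerivAt_φ t ht x (hsub x hx)).deriv]
  have bres : BddContOn (levelSetResidual u φ t) (G.elems M) :=
    (bφt.add (bddContOn_inner bu bg)).congr hres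
  obtain ⟨hLi, hL0⟩ := h.integral_fderiv_lagrangian ht
  have hEi : IntegrableOn
      (fun x => par.energyDensityDeriv (u t) (D.ut t) (φ t) (D.φt t) x) G.domain :=
    G.integrableOn_domain M (GeometryMap.bddContOn_slice (D.bddContOn_energyDensity h
      (singleton_subset_iff.2 ht) isCompact_singleton).2 (mem_singleton t))
  have hcomb := integral_combination
    (G.integrableOn_domain M (bddContOn_inner bu bdt))
    (G.integrableOn_domain M (bρ.mul (bddContOn_inner (bddContOn_apply bA bu) bu)))
    (G.integrableOn_domain M (bddContOn_inner bu (bρ.smul (bddContOn_const par.vert))))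
    (G.integrableOn_domain M (bddContOn_inner bu (bv.smul bg)))
    (G.integrableOn_domain M (bddContOn_inner bu (bB.smul bg)))
    (G.integrableOn_domain M (bv.mul bres))
    (G.integrableOn_domain M (bφt.mul (bv.add bB)))
    (G.integrableOn_domain M
      (bddContOn_inner (((bddContOn_const (1 / par.We)).mul bδ).smul bn) bgt))
    (G.integrableOn_domain M
      (((bddContOn_const (1 / par.We)).mul (br.mul bδ')).mul bφt)) (1 / par.Fr ^ 2)
  -- The right-hand side is supplied by `hcomb`. The pointwise identity is needed only off the null
  -- skeleton, where u and φ are differentiable.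
  have hpt : ∫ x in G.domain, (par.energyDensityDeriv (u t) (D.ut t) (φ t) (D.φt t) x
      - fderiv ℝ (par.lagrangian (u t) (φ t)) x (u t x)) = _ :=
    (G.setIntegral_domain_congr M fun x hx => ?_).trans hcomb
  · rw [integral_sub hEi hLi, hL0, sub_zero] at hpt
    unfold momentumForm at hmom
    unfold levelSetForm at hlev
    unfold additionalForm at hadd
    rw [hpt]
    linarith
  · obtain ⟨K, hK⟩ := mem_iUnion.1 hx
    have hud : DifferentiableAt ℝ (u t) x :=
      (G.contDiffAt_of_closure_elem (h.u_smooth t ht K) hK).differentiableAt (by norm_num)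
    have hφd : DifferentiableAt ℝ (φ t) x :=
      (G.contDiffAt_of_closure_elem (h.φ_smooth t ht K) hK).differentiableAt (by norm_num)
    rw [(par.fderiv_lagrangian hud hφd (u t x)).2, hres x hx,
      D.deriv_rho_smul par ht (hsub x hx), real_inner_comm (u t x) (fderiv ℝ (u t) x (u t x))]
    simp only [FlowParams.energyDensityDeriv, inner_add_right, real_inner_smul_right,
      real_inner_smul_left, real_inner_self_eq_norm_sq]
    ring

end Energy

end TwoPhase

end

/-! ### Assembly of the four assertions. -/

theorem mainTheorem2 {d : ℕ} (hd : d = 2 ∨ d = 3) (par : TwoPhase.FlowParams d)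
    (M : TwoPhase.KnotMesh d) (G : TwoPhase.GeometryMap d) (σ : TwoPhase.SplineType M)
    (N : TwoPhase.NurbsType M) (T : ℝ) (τ : M.Elem → ℝ → TwoPhase.Sp d → ℝ)
    (u : ℝ → TwoPhase.Sp d → TwoPhase.Sp d) (p φ v : ℝ → TwoPhase.Sp d → ℝ)
    (hsol : TwoPhase.IsSmoothSolution par M G σ N T τ u p φ v) :
    -- maximum principle for the density
    (par.rho2 ≤ par.rho1 → ∀ t ∈ Set.Ioo 0 T, ∀ x ∈ closure G.domain,
      par.rho2 ≤ par.rho (φ t x) ∧ par.rho (φ t x) ≤ par.rho1) ∧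
    -- the velocity is divergence-free, pointwise and as a distribution
    (∀ t ∈ Set.Ioo 0 T,
      (∀ K, ∀ x ∈ G.elem M K, DifferentiableAt ℝ (u t) x ∧ TwoPhase.divergence (u t) x = 0) ∧
      (∀ x ∈ G.domain, DifferentiableAt ℝ (u t) x → TwoPhase.divergence (u t) x = 0) ∧
      (∀ η : TwoPhase.Sp d → ℝ, ContDiff ℝ ∞ η → HasCompactSupport η → tsupport η ⊆ G.domain →
        ∫ x in G.domain, ⟪u t x, gradient η x⟫_ℝ = 0)) ∧
    -- energy dissipation
    (∀ t ∈ Set.Ioo 0 T,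
      MeasureTheory.IntegrableOn (par.energyDensity (u t) (φ t)) G.domain ∧
      MeasureTheory.IntegrableOn
        (fun x => TwoPhase.frob (fderiv ℝ (u t) x) (par.stress (u t) (φ t) x)) G.domain ∧
      (∀ K, MeasureTheory.IntegrableOn (fun x => TwoPhase.frob (fderiv ℝ (u t) x)
        (TwoPhase.dcViscosity par M G u p φ K t x • fderiv ℝ (u t) x)) (G.elem M K)) ∧
      HasDerivAt (fun s => TwoPhase.energy par G (u s) (φ s))
        (-TwoPhase.viscousTerm par G (u t) (φ t) (u t) - TwoPhase.dcTerm par M G u p φ t (u t)) t ∧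
      -TwoPhase.viscousTerm par G (u t) (φ t) (u t) - TwoPhase.dcTerm par M G u p φ t (u t) ≤ 0) ∧
    -- with the admissible weights `ψ = v` and `w = u` the two SUPG terms cancel
    (∀ t ∈ Set.Ioo 0 T, u t ∈ G.velocitySpace M σ ∧ v t ∈ G.scalarSpace M N ∧
      TwoPhase.supgLevelSet M G τ u φ t (v t) + TwoPhase.supgMomentum M G τ u φ v t (u t) = 0) := by
  refine ⟨fun hρ t _ x _ => par.rho_mem_Icc hρ _, fun t ht => ?_, fun t ht => ?_, fun t ht => ?_⟩
  · have hu := hsol.u_mem_velocitySpace ht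
    have hq := hsol.continuity t ht
    refine ⟨fun K x hx => ⟨?_, ?_⟩, fun x hx hd => ?_, fun η hη _ _ => ?_⟩
    · exact (G.contDiffAt_of_closure_elem (hu.2.2 K) hx).differentiableAt (by norm_num)
    · exact TwoPhase.divergence_eq_zero_of_mem_elems hu hq (G.elem_subset_elems M K hx)
    · exact TwoPhase.divergence_eq_zero_of_differentiableAt hu hq hx hd
    · exact TwoPhase.integral_inner_gradient_eq_zero hu hq (hη.of_le (by exact_mod_cast le_top))
  · obtain ⟨D⟩ := hsol.exists_timeDerivs
    obtain ⟨hE, hE'⟩ := D.hasDerivAt_energy hsol ht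
    rw [D.energy_balance hsol ht] at hE'
    refine ⟨hE, hsol.integrableOn_viscous ht, hsol.integrableOn_dc ht, hE', ?_⟩
    have h1 := TwoPhase.viscousTerm_self_nonneg (par := par) (G := G) (u t) (φ t)
    have h2 := TwoPhase.dcTerm_self_nonneg (par := par) (M := M) (G := G) (u := u) (p := p)
      (φ := φ) t
    linarith
  · exact ⟨hsol.u_mem_velocitySpace ht, hsol.v_mem_scalarSpace ht,
      TwoPhase.supgLevelSet_add_supgMomentum t⟩
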